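/- Let $f_U:\mathbb R^d\to[0,\infty)$ be measurable with $0<\int f_U<\infty$, let $f=f_U/\int f_U$, and let $q_0,K$ be functions on $\mathbb R^d$ such that: (H1) $f$ is a twice continuously differentiable probability density with bounded second derivatives; (H2) $q_0$ is a probability density; for every $\eta\in(0,1]$ there is $c_\eta>0$ with $f(x)^\eta\le c_\eta q_0(x)$ for all $x$; and there are $C_0,r_0>0$ with $q_0(x)\le C_0(1+\|x\|)^{-r_0}$ for all $x$; (H3) $K$ is a Lipschitz probability density with $\int uK(u)\,du=0$, $\int\|u\|^2K(u)\,du<\infty$, and there are $C_K,r_K>0$ with $K(x)\le C_K(1+\|x\|)^{-r_K}$ for all $x$. Let $(h_k)_{k\ge1}$ be positive bandwidths and $(\lambda_k)_{k\ge1}\subset(0,1]$ be nonincreasing. Let $(X_k)_{k\ge1}$ be random vectors in $\mathbb R^d$ generated by standard SAIS: with $\mathcal F_k=\sigma(X_1,\dots,X_k)$ ($\mathcal F_0$ trivial), for every $k\ge 0$ the conditional law of $X_{k+1}$ given $\mathcal F_k$ has density $q_k$, where for $k\ge1$ $$q_k=(1-\lambda_k)f_k+\lambda_kq_0,\qquad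 f_k(x)=\sum_{j=1}^kW_{k,j}\,h_k^{-d}K\big((x-X_j)/h_k\big),$$ $W_j=f_U(X_j)/q_{j-1}(X_j)$, and $W_{k,j}=W_j/\sum_{i=1}^kW_i$ (with the convention $W_{k,j}=1/k$ if $W_1=\dots=W_k=0$). Put $a_n=\sqrt{\log n/(nh_n^d)}$ and suppose that for some $\epsilon>0$, as $n\to\infty$, $a_n+h_n^4=o(\lambda_n^{1+\epsilon})$ and $\lambda_n^{1+\epsilon}\to0$. Then for every measurable $g:\mathbb R^d\to\mathbb R$ with $\int g^2q_0<\infty$, the integrals $\int gf$ and $\int g^2f$ converge absolutely and $$\sqrt n\Big(\sum_{k=1}^nW_{n,k}\,g(X_k)-\int gf\Big)\longrightarrow\mathcal N\big(0,V(f,g)\big)\quad\text{in law},$$ where $V(q,g)=\int g^2f^2/q-\big(\int gf\big)^2$ (with $0/0=0$), so that $V(f,g)=\int g^2f-\big(\int gf\big)^2$. This is the oracle variance, i.e. the variance of $g(X)f(X)/q(X)$, $X\sim q$, for the importance sampling policy $q=f$. -/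

import Mathlib

open MeasureTheory ProbabilityTheory Filter Asymptotics Topology

noncomputable section

namespace SAIS

/-- The Euclidean space `ℝ^d`. -/
abbrev E (d : ℕ) : Type := EuclideanSpace ℝ (Fin d)

/-- Probability density functions with respect to Lebesgue measure
(integral equal to `1` forces integrability). -/
structure IsPDF {d : ℕ} (p : E d → ℝ) : Prop where
  measurable : Measurable p
  nonneg : ∀ x, 0 ≤ p x
  integral_eq_one : ∫ x, p x = 1

/-- Unnormalized targets: measurable, nonnegative, with `0 < ∫ f_U < ∞`. -/
structure IsUnnormalizedTarget {d : ℕ} (fU : E d → ℝ) : Prop where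
  measurable : Measurable fU
  nonneg : ∀ x, 0 ≤ fU x
  integrable : Integrable fU
  integral_pos : 0 < ∫ x, fU x

/-- The target density `f = f_U / ∫ f_U`. -/
def target {d : ℕ} (fU : E d → ℝ) (x : E d) : ℝ := fU x / ∫ y, fU y

/-- (H1): `f` is a twice continuously differentiable probability density with bounded second
derivatives. -/
structure H1 {d : ℕ} (f : E d → ℝ) : Prop where
  pdf : IsPDF f
  contDiff : ContDiff ℝ 2 f
  bounded : ∃ C : ℝ, ∀ x, ‖iteratedFDeriv ℝ 2 f x‖ ≤ C

/-- (H2): `q₀` is a probability density dominating all powers `f ^ η`, `η ∈ (0, 1]`, with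
polynomially decaying tails. -/
structure H2 {d : ℕ} (f q₀ : E d → ℝ) : Prop where
  pdf : IsPDF q₀
  dominates : ∀ η : ℝ, 0 < η → η ≤ 1 → ∃ c : ℝ, 0 < c ∧ ∀ x, f x ^ η ≤ c * q₀ x
  tail : ∃ C₀ r₀ : ℝ, 0 < C₀ ∧ 0 < r₀ ∧ ∀ x, q₀ x ≤ C₀ * (1 + ‖x‖) ^ (-r₀)

/-- (H3): `K` is a centered Lipschitz probability density with finite second moment and
polynomially decaying tails. -/
structure H3 {d : ℕ} (K : E d → ℝ) : Prop where
  pdf : IsPDF K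
  lipschitz : ∃ L : NNReal, LipschitzWith L K
  centered : ∫ u, K u • u = 0
  second_moment : Integrable fun u : E d => ‖u‖ ^ 2 * K u
  tail : ∃ C r : ℝ, 0 < C ∧ 0 < r ∧ ∀ x, K x ≤ C * (1 + ‖x‖) ^ (-r)

/-- The rescaled kernel `K_h(u) = K(u / h) / h ^ d`. -/
def scaledKernel {d : ℕ} (K : E d → ℝ) (h : ℝ) (u : E d) : ℝ := K (h⁻¹ • u) / h ^ d

/-- The importance weight `W_k = f_U(X_k) / q_{k-1}(X_k)`, `k ≥ 1`, along a sequence of particles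
`x` and a sequence of densities `q`. -/
def weight {d : ℕ} (fU : E d → ℝ) (q : ℕ → E d → ℝ) (x : ℕ → E d) (k : ℕ) : ℝ :=
  fU (x k) / q (k - 1) (x k)

/-- The normalized importance weights `W_{n,k}`, `1 ≤ k ≤ n`: proportional to `W_k`, with sum `1`.
If `W_1 = ⋯ = W_n = 0`, they are uniform by convention. -/
def normWeight {d : ℕ} (fU : E d → ℝ) (q : ℕ → E d → ℝ) (x : ℕ → E d) (n k : ℕ) : ℝ :=
  open Classical in
  if ∑ j ∈ Finset.Icc 1 n, weight fU q x j = 0 then 1 / (n : ℝ)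
  else weight fU q x k / ∑ j ∈ Finset.Icc 1 n, weight fU q x j

/-- The normalized estimate `∑_{k=1}^n W_{n,k} g(X_k)`. -/
def estimate {d : ℕ} (fU : E d → ℝ) (q : ℕ → E d → ℝ) (x : ℕ → E d) (g : E d → ℝ) (n : ℕ) : ℝ :=
  ∑ k ∈ Finset.Icc 1 n, normWeight fU q x n k * g (x k)

/-- The kernel estimate `f_n(y) = ∑_{k=1}^n W_{n,k} K_{h_n}(y - X_k)`. -/
def kernelEstimate {d : ℕ} (fU : E d → ℝ) (q : ℕ → E d → ℝ) (x : ℕ → E d) (K : E d → ℝ)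
    (h : ℕ → ℝ) (n : ℕ) (y : E d) : ℝ :=
  ∑ k ∈ Finset.Icc 1 n, normWeight fU q x n k * scaledKernel K (h n) (y - x k)

/-- `F_k = σ(X_1, …, X_k)`; `F_0` is trivial. -/
abbrev history {d : ℕ} {Ω : Type*} (X : ℕ → Ω → E d) (k : ℕ) : MeasurableSpace Ω :=
  ⨆ j ∈ Finset.Icc 1 k, MeasurableSpace.comap (X j) inferInstance

/-- `(q_k)_{k ≥ 0}` is the policy of the random sequence `(X_k)_{k ≥ 1}`: the `q_k` are random
probability densities adapted to `(F_k)`, and conditionally on `F_k`, `X_{k+1}` has density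
`q_k`. (`X 0` plays no role.) -/
structure IsPolicy {d : ℕ} {Ω : Type*} [MeasurableSpace Ω] (μ : Measure Ω) (X : ℕ → Ω → E d)
    (q : ℕ → Ω → E d → ℝ) : Prop where
  measurable : ∀ k, 1 ≤ k → Measurable (X k)
  pdf : ∀ k ω, IsPDF (q k ω)
  adapted : ∀ k, Measurable[(history X k).prod inferInstance] (Function.uncurry (q k))
  cond_law : ∀ k, ∀ A : Set (E d), MeasurableSet A →
    μ[(X (k + 1) ⁻¹' A).indicator (fun _ => (1 : ℝ)) | history X k]
      =ᵐ[μ] fun ω => ∫ y in A, q k ω y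

/-- Standard SAIS with initial density `q₀`, mixture weights `lam` and bandwidths `h`: the policy
of `X` starts at `q₀` and is updated by `q_k = (1 - λ_k) f_k + λ_k q₀` for `k ≥ 1`. -/
structure IsStandardSAIS {d : ℕ} {Ω : Type*} [MeasurableSpace Ω] (μ : Measure Ω)
    (fU q₀ K : E d → ℝ) (lam h : ℕ → ℝ) (X : ℕ → Ω → E d) (q : ℕ → Ω → E d → ℝ) : Prop where
  policy : IsPolicy μ X q
  init : ∀ ω, q 0 ω = q₀
  update : ∀ k, 1 ≤ k → ∀ ω y, q k ω y =
    (1 - lam k) * kernelEstimate fU (fun j => q j ω) (fun j => X j ω) K h k y + lam k * q₀ y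

/-- `a_n = √(log n / (n h_n ^ d))`. -/
def rate (d : ℕ) (h : ℕ → ℝ) (n : ℕ) : ℝ := √(Real.log n / (n * h n ^ d))

/-- `V(q, g) = ∫ g² f² / q - (∫ g f)²`, with the convention `0 / 0 = 0`. -/
def V {d : ℕ} (f q g : E d → ℝ) : ℝ :=
  (∫ x, g x ^ 2 * f x ^ 2 / q x) - (∫ x, g x * f x) ^ 2

/-- The one-draw variance of importance sampling of `∫ g f` with policy `q`, that is the variance
of `(f(X) / q(X)) g(X)` for `X` with density `q`. -/
def importanceVariance {d : ℕ} (f q g : E d → ℝ) : ℝ :=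
  Var[fun x => f x / q x * g x; (volume : Measure (E d)).withDensity fun x => ENNReal.ofReal (q x)]

end SAIS

end

/-! Put ψ = g − ∫gf and D_k = f(X_{k+1}) ψ(X_{k+1}) / q_k(X_{k+1}). Where the average importance
weight is nonzero, √n times the estimation error is n^{-1/2} ∑ D_k divided by that average. The
policy q_k cancels in conditional means, so E[D_k | F_k] = ∫fψ = 0, while E[D_k² | F_k] = ∫ψ²
f²/q_k. The oracle variance ∫ψ²f therefore appears once ∫ψ² E|f²/q_n − f| → 0
(`tendsto_integral_abs_sq_div_sub`); the same quantity also controls the Lindeberg term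
(`sq_div_mul_min_le`).

No uniform or almost sure convergence of f_n is needed, only second moments at each fixed x
(`exists_pointwise_bound`). The threshold is f(x) = λ_n^{(1+ε)/2}. Below it, q_n ≥ λ_n q₀ together
with f^{ε/(1+ε)} ≤ a q₀ makes f²/q_n at most a² q₀. Above it, the bias O(h_n²) is negligible against
f(x), and Chebyshev applied to the numerator and denominator of f_n(x) shows that q_n(x) is close to
f(x); the exceptional event costs O(λ_n^ε q₀(x)). Hence the mean error is O(q₀(x)) and tends to 0
for each x, and dominated convergence with majorant a multiple of ψ² q₀ concludes.

The central limit theorem is proved by characteristic functions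
(`tendstoInDistribution_sum_of_charFun_increments`), and Slutsky's lemma handles the normalization,
because the average weight tends to 1 in probability. -/

noncomputable section

namespace SAIS

/-! ### Joint law of the past and the next particle. -/

section Disintegration

variable {Ω S Y : Type*} [MeasurableSpace Ω] [MeasurableSpace S] [MeasurableSpace Y]
  {μ : Measure Ω} [IsFiniteMeasure μ] {ν : Measure Y} [SFinite ν]
  {T : Ω → S} {Z : Ω → Y} {p : S → Y → ℝ}

/-- Finite measures on a product are determined by rectangles. `T` is general so that it can later
be the identity of Ω, with the history σ-algebra on its target. -/
theorem map_prodMk_eq_withDensity (hT : Measurable T) (hZ : Measurable Z)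
    (hp : Measurable (Function.uncurry p))
    (hlaw : ∀ A B, MeasurableSet A → MeasurableSet B →
      μ (T ⁻¹' A ∩ Z ⁻¹' B) = ∫⁻ ω in T ⁻¹' A, ∫⁻ y in B, ENNReal.ofReal (p (T ω) y) ∂ν ∂μ) :
    μ.map (fun ω => (T ω, Z ω)) =
      ((μ.map T).prod ν).withDensity (fun z => ENNReal.ofReal (Function.uncurry p z)) := by
  refine Measure.ext_prod fun {A B} hA hB => ?_
  rw [Measure.map_apply (hT.prodMk hZ) (hA.prod hB), withDensity_apply _ (hA.prod hB),
    ← Measure.prod_restrict, lintegral_prod _ (by fun_prop), setLIntegral_map hA ?_ hT]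
  · exact hlaw A B hA hB
  · exact Measurable.lintegral_prod_right' (f := fun z => ENNReal.ofReal (Function.uncurry p z))
      (by fun_prop)

variable {G : Type*} [NormedAddCommGroup G] [NormedSpace ℝ G]

theorem integral_comp_prodMk (hT : Measurable T) (hZ : Measurable Z)
    (hp : Measurable (Function.uncurry p)) (hp0 : ∀ s y, 0 ≤ p s y)
    (hmap : μ.map (fun ω => (T ω, Z ω)) =
      ((μ.map T).prod ν).withDensity (fun z => ENNReal.ofReal (Function.uncurry p z)))
    {H : S × Y → G} (hH : StronglyMeasurable H) :
    ∫ ω, H (T ω, Z ω) ∂μ = ∫ z, p (T z.1) z.2 • H (T z.1, z.2) ∂(μ.prod ν) := by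
  have e : (μ.map T).prod ν = (μ.prod ν).map (Prod.map T id) := by
    conv_lhs => rw [← Measure.map_id (μ := ν)]
    exact Measure.map_prod_map _ _ hT measurable_id
  rw [← integral_map (φ := fun ω => (T ω, Z ω)) (hT.prodMk hZ).aemeasurable
    hH.aestronglyMeasurable, hmap, integral_withDensity_eq_integral_toReal_smul (by fun_prop)
    (ae_of_all _ fun _ => ENNReal.ofReal_lt_top), e, integral_map (by fun_prop)]
  · refine integral_congr_ae (ae_of_all _ fun z => ?_)
    simp [Function.uncurry, ENNReal.toReal_ofReal (hp0 _ _), Prod.map]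
  · refine (StronglyMeasurable.smul ?_ hH).aestronglyMeasurable
    exact (by fun_prop : Measurable
      fun z => (ENNReal.ofReal (Function.uncurry p z)).toReal).stronglyMeasurable

theorem integrable_comp_prodMk_iff (hT : Measurable T) (hZ : Measurable Z)
    (hp : Measurable (Function.uncurry p)) (hp0 : ∀ s y, 0 ≤ p s y)
    (hmap : μ.map (fun ω => (T ω, Z ω)) =
      ((μ.map T).prod ν).withDensity (fun z => ENNReal.ofReal (Function.uncurry p z)))
    {H : S × Y → G} (hH : StronglyMeasurable H) :
    Integrable (fun ω => H (T ω, Z ω)) μ ↔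
      Integrable (fun z => p (T z.1) z.2 • H (T z.1, z.2)) (μ.prod ν) := by
  have e : (μ.map T).prod ν = (μ.prod ν).map (Prod.map T id) := by
    conv_lhs => rw [← Measure.map_id (μ := ν)]
    exact Measure.map_prod_map _ _ hT measurable_id
  have h1 := integrable_map_measure (μ := μ) (f := fun ω => (T ω, Z ω)) (g := H)
    hH.aestronglyMeasurable (hT.prodMk hZ).aemeasurable
  change Integrable (H ∘ _) μ ↔ _
  rw [← h1, hmap, integrable_withDensity_iff_integrable_smul' (by fun_prop)
    (ae_of_all _ fun _ => ENNReal.ofReal_lt_top), e, integrable_map_measure _ (by fun_prop)]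
  · refine integrable_congr (ae_of_all _ fun z => ?_)
    simp [Function.uncurry, ENNReal.toReal_ofReal (hp0 _ _), Prod.map]
  · refine (StronglyMeasurable.smul ?_ hH).aestronglyMeasurable
    exact (by fun_prop : Measurable
      fun z => (ENNReal.ofReal (Function.uncurry p z)).toReal).stronglyMeasurable

end Disintegration

theorem IsPDF.integrable {d : ℕ} {p : E d → ℝ} (hp : IsPDF p) : Integrable p := by
  by_contra h
  have := hp.integral_eq_one
  rw [integral_undef h] at this
  exact zero_ne_one this

namespace IsPolicy

variable {d : ℕ} {Ω : Type*} [mΩ : MeasurableSpace Ω] {μ : Measure Ω}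
  {X : ℕ → Ω → E d} {q : ℕ → Ω → E d → ℝ}

theorem history_le (hP : IsPolicy μ X q) (k : ℕ) : history X k ≤ mΩ :=
  iSup₂_le fun j hj => (hP.measurable j (Finset.mem_Icc.1 hj).1).comap_le

variable [IsProbabilityMeasure μ]

/-- Conditioning is encoded by the σ-algebra: with `T = id` into Ω carrying `history X k`, the
rectangle condition is the defining property of the conditional expectation on sets `A` of the
history. -/
theorem map_eq (hP : IsPolicy μ X q) (k : ℕ) :
    @Measure.map Ω (Ω × E d) mΩ ((history X k).prod inferInstance) (fun ω => (ω, X (k + 1) ω)) μ =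
      @Measure.withDensity _ ((history X k).prod inferInstance)
      (@Measure.prod _ _ (history X k) _ (@Measure.map Ω Ω mΩ (history X k) id μ) volume)
      (fun z => ENNReal.ofReal (Function.uncurry (q k) z)) := by
  have hle := hP.history_le k
  refine @map_prodMk_eq_withDensity Ω Ω (E d) mΩ (history X k) _ μ _ volume _ id (X (k + 1)) (q k)
    (measurable_id'' hle) (hP.measurable _ (by omega)) (hP.adapted k) ?_
  intro A B hA hB
  have hXB : MeasurableSet (X (k + 1) ⁻¹' B) := hP.measurable _ (by omega) hB
  have hA' : MeasurableSet A := hle A hA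
  have hq : Measurable (Function.uncurry (q k)) :=
    (hP.adapted k).mono (sup_le_sup_right (MeasurableSpace.comap_mono hle) _) le_rfl
  have h1 : ∫ ω in A, (∫ y in B, q k ω y) ∂μ = μ.real (A ∩ X (k + 1) ⁻¹' B) := by
    rw [← setIntegral_congr_ae hA' ((hP.cond_law k B hB).mono fun ω h _ => h),
      setIntegral_condExp hle _ hA, setIntegral_indicator hXB]
    · simp
    · exact (integrable_const _).indicator hXB
  have hm : Measurable fun ω => ∫ y in B, q k ω y :=
    (hq.stronglyMeasurable.integral_prod_right (ν := volume.restrict B)).measurable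
  have hb : ∀ ω, 0 ≤ ∫ y in B, q k ω y := fun ω =>
    integral_nonneg fun y => (hP.pdf k ω).nonneg y
  have hb1 : ∀ ω, ∫ y in B, q k ω y ≤ 1 := fun ω =>
    (setIntegral_le_integral (hP.pdf k ω).integrable
      (ae_of_all _ (hP.pdf k ω).nonneg)).trans_eq (hP.pdf k ω).integral_eq_one
  have hint : Integrable (fun ω => ∫ y in B, q k ω y) μ :=
    (integrable_const (1 : ℝ)).mono' hm.aestronglyMeasurable
      (ae_of_all _ fun ω => by rw [Real.norm_of_nonneg (hb ω)]; exact hb1 ω)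
  have h2 : ∀ ω, ∫⁻ y in B, ENNReal.ofReal (q k ω y) = ENNReal.ofReal (∫ y in B, q k ω y) :=
    fun ω => (ofReal_integral_eq_lintegral_ofReal (hP.pdf k ω).integrable.integrableOn
      (ae_of_all _ (hP.pdf k ω).nonneg)).symm
  simp only [Set.preimage_id, id, h2]
  rw [← ofReal_integral_eq_lintegral_ofReal hint.integrableOn (ae_of_all _ hb), h1,
    ofReal_measureReal]

variable {G : Type*} [NormedAddCommGroup G] [NormedSpace ℝ G]

/-- The law of `X_{k+1}` given the history has density `q_k`, at the level of integrals. -/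
theorem integral_next (hP : IsPolicy μ X q) (k : ℕ) {H : Ω × E d → G}
    (hH : StronglyMeasurable[(history X k).prod inferInstance] H) :
    ∫ ω, H (ω, X (k + 1) ω) ∂μ = ∫ z, q k z.1 z.2 • H z ∂(μ.prod volume) :=
  @integral_comp_prodMk Ω Ω (E d) mΩ (history X k) _ μ _ volume _ id (X (k + 1)) (q k) G _ _
    (measurable_id'' (hP.history_le k)) (hP.measurable _ (by omega)) (hP.adapted k)
    (fun ω => (hP.pdf k ω).nonneg) (hP.map_eq k) H hH

theorem integrable_next_iff (hP : IsPolicy μ X q) (k : ℕ) {H : Ω × E d → G}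
    (hH : StronglyMeasurable[(history X k).prod inferInstance] H) :
    Integrable (fun ω => H (ω, X (k + 1) ω)) μ ↔
      Integrable (fun z => q k z.1 z.2 • H z) (μ.prod volume) :=
  @integrable_comp_prodMk_iff Ω Ω (E d) mΩ (history X k) _ μ _ volume _ id (X (k + 1)) (q k) G _ _
    (measurable_id'' (hP.history_le k)) (hP.measurable _ (by omega)) (hP.adapted k)
    (fun ω => (hP.pdf k ω).nonneg) (hP.map_eq k) H hH

end IsPolicy

/-! ### Martingale central limit theorem by characteristic functions. -/

section MartingaleCLT

/-- The bound is cubic for small x and quadratic for large x, so that finite second moments suffice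
for the remainder. -/
theorem norm_exp_mul_I_taylor_two_le (x : ℝ) :
    ‖Complex.exp (x * Complex.I) - 1 - x * Complex.I + (x : ℂ) ^ 2 / 2‖ ≤ 4 * x ^ 2 * min 1 |x| := by
  have hn : ‖(x : ℂ) * Complex.I‖ = |x| := by simp
  rcases le_total |x| 1 with h | h
  · rw [min_eq_right h]
    have := Complex.exp_bound (x := x * Complex.I) (by rw [hn]; exact h) (n := 3) (by norm_num)
    rw [hn] at this
    have e : Complex.exp (x * Complex.I) - 1 - x * Complex.I + (x : ℂ) ^ 2 / 2 =
        Complex.exp (x * Complex.I) - ∑ m ∈ Finset.range 3, (x * Complex.I) ^ m / m.factorial := by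
      simp [Finset.sum_range_succ, mul_pow, Nat.factorial]
      ring
    rw [e]
    refine this.trans ?_
    have h3 : |x| ^ 3 = x ^ 2 * |x| := by rw [pow_succ, sq_abs]
    rw [h3]
    have : 0 ≤ x ^ 2 * |x| := by positivity
    norm_num [Nat.factorial]
    nlinarith
  · rw [min_eq_left h, mul_one]
    have h1 : ‖Complex.exp (x * Complex.I)‖ = 1 := Complex.norm_exp_ofReal_mul_I x
    have h2 : ‖(x : ℂ) ^ 2 / 2‖ = x ^ 2 / 2 := by simp
    have hx : |x| ≤ x ^ 2 := by rw [← sq_abs]; nlinarith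
    calc _ ≤ ‖Complex.exp (x * Complex.I)‖ + ‖(1 : ℂ)‖ + ‖(x : ℂ) * Complex.I‖
          + ‖(x : ℂ) ^ 2 / 2‖ := (norm_add_le _ _).trans
            (by gcongr; exact (norm_sub_le _ _).trans (by gcongr; exact norm_sub_le _ _))
      _ ≤ 4 * x ^ 2 := by
        rw [h1, h2, hn, norm_one]
        nlinarith

theorem abs_one_sub_sub_exp_neg_le {y : ℝ} (hy : 0 ≤ y) : |1 - y - Real.exp (-y)| ≤ y ^ 2 := by
  have h1 : -y + 1 ≤ Real.exp (-y) := Real.add_one_le_exp _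
  rw [abs_le]
  refine ⟨?_, by nlinarith [sq_nonneg y]⟩
  rcases le_total y 1 with h | h
  · have := (abs_le.1 (Real.abs_exp_sub_one_sub_id_le (x := -y) (by rw [abs_neg, abs_of_nonneg hy]; exact h))).2
    nlinarith
  · have : Real.exp (-y) ≤ 1 := Real.exp_le_one_iff.2 (by linarith)
    nlinarith

variable {Ω : Type*} [MeasurableSpace Ω] {μ : Measure Ω} [IsProbabilityMeasure μ]

/-- One step of the recursion for the characteristic function. The comparison factor is the
deterministic exp(−s²v/2), so the fluctuation of the conditional variance enters only through `A`.
-/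
theorem norm_integral_exp_add_sub_le {S D : Ω → ℝ} (hS : Measurable S) (hD : Measurable D)
    (hD2 : Integrable (fun ω => D ω ^ 2) μ) {s v A B : ℝ} (hv : 0 ≤ v)
    (h0 : ∫ ω, Complex.exp ((s * S ω : ℝ) * Complex.I) * (D ω : ℂ) ∂μ = 0)
    (hA : ‖∫ ω, Complex.exp ((s * S ω : ℝ) * Complex.I) * ((D ω ^ 2 - v : ℝ) : ℂ) ∂μ‖ ≤ A)
    (hB : ∫ ω, D ω ^ 2 * min 1 |s * D ω| ∂μ ≤ B) :
    ‖∫ ω, Complex.exp ((s * (S ω + D ω) : ℝ) * Complex.I) ∂μ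
      - Real.exp (-(s ^ 2 * v / 2)) * ∫ ω, Complex.exp ((s * S ω : ℝ) * Complex.I) ∂μ‖
      ≤ s ^ 2 * (A + 4 * B) + s ^ 4 * v ^ 2 := by
  set e : Ω → ℂ := fun ω => Complex.exp ((s * S ω : ℝ) * Complex.I) with he
  have hem : Measurable e := by fun_prop
  have hen : ∀ ω, ‖e ω‖ = 1 := fun ω => Complex.norm_exp_ofReal_mul_I _
  have hei : ∀ {F : Ω → ℂ}, Integrable F μ → Integrable (fun ω => e ω * F ω) μ := fun hF =>
    hF.bdd_mul hem.aestronglyMeasurable (c := 1) (ae_of_all _ fun ω => (hen ω).le)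
  have hD1 : Integrable D μ := by
    refine (hD2.add (integrable_const 1)).mono' hD.aestronglyMeasurable (ae_of_all _ fun ω => ?_)
    simp only [Real.norm_eq_abs, Pi.add_apply]
    rw [← sq_abs]
    nlinarith [sq_nonneg (|D ω| - 1), abs_nonneg (D ω)]
  set R : Ω → ℂ := fun ω => Complex.exp ((s * D ω : ℝ) * Complex.I) - 1 -
    (s * D ω : ℝ) * Complex.I + ((s * D ω : ℝ) : ℂ) ^ 2 / 2 with hR
  have hRm : Measurable R := by fun_prop
  have hRb : ∀ ω, ‖R ω‖ ≤ 4 * s ^ 2 * (D ω ^ 2 * min 1 |s * D ω|) := fun ω =>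
    (norm_exp_mul_I_taylor_two_le _).trans_eq (by ring)
  have hDi : Integrable (fun ω => D ω ^ 2 * min 1 |s * D ω|) μ := by
    refine hD2.mono' (by fun_prop) (ae_of_all _ fun ω => ?_)
    rw [Real.norm_of_nonneg (by positivity)]
    exact mul_le_of_le_one_right (sq_nonneg _) (min_le_left _ _)
  have hRi : Integrable R μ :=
    (hDi.const_mul (4 * s ^ 2)).mono' hRm.aestronglyMeasurable (ae_of_all _ hRb)
  set r : ℝ := 1 - s ^ 2 * v / 2 - Real.exp (-(s ^ 2 * v / 2)) with hr
  have hDv : Integrable (fun ω => ((D ω ^ 2 - v : ℝ) : ℂ)) μ := (hD2.sub (integrable_const v)).ofReal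
  -- Four contributions: Taylor remainder, linear term (zero by `h0`), deviation of D² from v, and
  -- the error `r` of replacing 1 − s²v/2 by its exponential.
  have key : ∫ ω, Complex.exp ((s * (S ω + D ω) : ℝ) * Complex.I) ∂μ
      - Real.exp (-(s ^ 2 * v / 2)) * ∫ ω, e ω ∂μ
      = ∫ ω, e ω * R ω ∂μ + s * Complex.I * ∫ ω, e ω * (D ω : ℂ) ∂μ
        - (s : ℂ) ^ 2 / 2 * ∫ ω, e ω * ((D ω ^ 2 - v : ℝ) : ℂ) ∂μ + r * ∫ ω, e ω ∂μ := by
    have i1 := hei hRi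
    have i2 : Integrable (fun ω => s * Complex.I * (e ω * (D ω : ℂ))) μ :=
      (hei hD1.ofReal).const_mul _
    have i3 := (hei hDv).const_mul ((s : ℂ) ^ 2 / 2)
    have i5 : Integrable e μ := by simpa using hei (integrable_const (1 : ℂ))
    have i4 : Integrable (fun ω => (r : ℂ) * e ω) μ := i5.const_mul _
    have i5' : Integrable (fun ω => (Real.exp (-(s ^ 2 * v / 2)) : ℂ) * e ω) μ := i5.const_mul _
    have i6 : Integrable (fun ω => Complex.exp ((s * (S ω + D ω) : ℝ) * Complex.I)) μ :=
      (integrable_const (1 : ℝ)).mono' (by fun_prop)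
        (ae_of_all _ fun ω => (Complex.norm_exp_ofReal_mul_I _).le)
    have i12 : Integrable (fun ω => e ω * R ω + s * Complex.I * (e ω * (D ω : ℂ))) μ := i1.add i2
    have i123 : Integrable (fun ω => e ω * R ω + s * Complex.I * (e ω * (D ω : ℂ))
        - (s : ℂ) ^ 2 / 2 * (e ω * ((D ω ^ 2 - v : ℝ) : ℂ))) μ := i12.sub i3
    rw [← integral_const_mul, ← integral_const_mul, ← integral_const_mul, ← integral_const_mul,
      ← integral_sub i6 i5', ← integral_add i1 i2, ← integral_sub i12 i3,
      ← integral_add i123 i4]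
    refine integral_congr_ae (ae_of_all _ fun ω => ?_)
    have : Complex.exp ((s * (S ω + D ω) : ℝ) * Complex.I) =
        e ω * Complex.exp ((s * D ω : ℝ) * Complex.I) := by
      rw [he, ← Complex.exp_add]; push_cast; ring_nf
    simp only [this, hR, hr]
    push_cast
    ring
  have hr' : |r| ≤ s ^ 4 * v ^ 2 := (abs_one_sub_sub_exp_neg_le (by positivity)).trans
    (by nlinarith [sq_nonneg (s ^ 2 * v)])
  have hE : ‖∫ ω, e ω ∂μ‖ ≤ 1 := by
    refine (norm_integral_le_integral_norm _).trans ?_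
    simp [hen]
  have hER : ‖∫ ω, e ω * R ω ∂μ‖ ≤ 4 * s ^ 2 * B := by
    refine (norm_integral_le_of_norm_le (hDi.const_mul (4 * s ^ 2))
      (ae_of_all _ fun ω => ?_)).trans ?_
    · rw [norm_mul, hen, one_mul]; exact hRb ω
    · rw [integral_const_mul]; gcongr
  rw [key, h0, mul_zero, add_zero]
  have hA0 : 0 ≤ A := (norm_nonneg _).trans hA
  calc _ ≤ ‖∫ ω, e ω * R ω ∂μ‖ + ‖(s : ℂ) ^ 2 / 2‖ * ‖∫ ω, e ω * ((D ω ^ 2 - v : ℝ) : ℂ) ∂μ‖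
        + ‖(r : ℂ)‖ * ‖∫ ω, e ω ∂μ‖ := by
        rw [← norm_mul, ← norm_mul]
        exact (norm_add_le _ _).trans (by gcongr; exact norm_sub_le _ _)
    _ ≤ 4 * s ^ 2 * B + s ^ 2 / 2 * A + s ^ 4 * v ^ 2 * 1 := by
        have : ‖(s : ℂ) ^ 2 / 2‖ = s ^ 2 / 2 := by simp
        rw [this, Complex.norm_real, Real.norm_eq_abs]
        gcongr
    _ ≤ _ := by nlinarith [mul_nonneg (sq_nonneg s) hA0]

/-- Since ‖ρ‖ ≤ 1, earlier errors are not amplified and simply add up. -/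
theorem norm_sub_pow_le_sum {φ : ℕ → ℂ} {ρ : ℂ} {b : ℕ → ℝ} (h0 : φ 0 = 1) (hρ : ‖ρ‖ ≤ 1)
    (h : ∀ k, ‖φ (k + 1) - ρ * φ k‖ ≤ b k) (n : ℕ) :
    ‖φ n - ρ ^ n‖ ≤ ∑ k ∈ Finset.range n, b k := by
  induction n with
  | zero => simp [h0]
  | succ n ih =>
    rw [Finset.sum_range_succ]
    calc ‖φ (n + 1) - ρ ^ (n + 1)‖ = ‖(φ (n + 1) - ρ * φ n) + ρ * (φ n - ρ ^ n)‖ := by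
          congr 1; ring
      _ ≤ b n + 1 * ∑ k ∈ Finset.range n, b k := by
          refine (norm_add_le _ _).trans ?_
          rw [norm_mul]
          gcongr
          exact h n
      _ = _ := by ring

/-- A central limit theorem for sums of martingale increments, under convergence in mean of the
conditional variances and a Lindeberg-type condition. -/
theorem tendstoInDistribution_sum_of_charFun_increments {D : ℕ → Ω → ℝ}
    (hD : ∀ k, Measurable (D k)) (hD2 : ∀ k, Integrable (fun ω => D k ω ^ 2) μ) {v : ℝ} (hv : 0 ≤ v)
    {A : ℕ → ℝ} {B : ℝ → ℝ} (hA : Tendsto A atTop (𝓝 0)) (hB : Tendsto B (𝓝 0) (𝓝 0))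
    (h0 : ∀ k (s : ℝ), ∫ ω, Complex.exp ((s * ∑ j ∈ Finset.range k, D j ω : ℝ) * Complex.I)
      * (D k ω : ℂ) ∂μ = 0)
    (h1 : ∀ k (s : ℝ), ‖∫ ω, Complex.exp ((s * ∑ j ∈ Finset.range k, D j ω : ℝ) * Complex.I)
      * ((D k ω ^ 2 - v : ℝ) : ℂ) ∂μ‖ ≤ A k)
    (h2 : ∀ k (s : ℝ), ∫ ω, D k ω ^ 2 * min 1 |s * D k ω| ∂μ ≤ A k + B s) :
    TendstoInDistribution (fun (n : ℕ) ω => (√n)⁻¹ * ∑ k ∈ Finset.range n, D k ω) atTop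
      (id : ℝ → ℝ) (fun _ => μ) (gaussianReal 0 v.toNNReal) where
  forall_aemeasurable n := by fun_prop
  tendsto := by
    refine ProbabilityMeasure.tendsto_iff_tendsto_charFun.2 fun t => ?_
    simp only [ProbabilityMeasure.coe_mk, Measure.map_id]
    rw [charFun_gaussianReal, tendsto_iff_norm_sub_tendsto_zero]
    have hs : Tendsto (fun n : ℕ => t * (√n)⁻¹) atTop (𝓝 0) := by
      rw [← mul_zero t]
      exact (tendsto_inv_atTop_zero.comp <| Real.tendsto_sqrt_atTop.comp
        tendsto_natCast_atTop_atTop).const_mul t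
    -- At s = t/√n the factor s² turns the sum of n one-step errors into a Cesàro mean. `A` occurs 1
    -- + 4 times: once for the variance and four times through the remainder.
    have hlim : Tendsto (fun n : ℕ => t ^ 2 * (5 * ((n : ℝ)⁻¹ * ∑ k ∈ Finset.range n, A k)
        + 4 * B (t * (√n)⁻¹)) + t ^ 4 * v ^ 2 * (n : ℝ)⁻¹) atTop (𝓝 0) := by
      have := (((hA.cesaro.const_mul 5).add ((hB.comp hs).const_mul 4)).const_mul (t ^ 2)).add
        ((tendsto_inv_atTop_zero.comp tendsto_natCast_atTop_atTop).const_mul (t ^ 4 * v ^ 2))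
      simpa using this
    refine tendsto_of_tendsto_of_tendsto_of_le_of_le' tendsto_const_nhds hlim
      (Eventually.of_forall fun _ => norm_nonneg _) ?_
    filter_upwards [eventually_ge_atTop 1] with n hn
    have hn0 : (0 : ℝ) < n := by exact_mod_cast hn
    set s : ℝ := t * (√n)⁻¹ with hsdef
    have hs2 : s ^ 2 = t ^ 2 * (n : ℝ)⁻¹ := by
      rw [hsdef, mul_pow, inv_pow, Real.sq_sqrt hn0.le]
    set φ : ℕ → ℂ := fun k =>
      ∫ ω, Complex.exp ((s * ∑ j ∈ Finset.range k, D j ω : ℝ) * Complex.I) ∂μ with hφ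
    have hstep : ∀ k, ‖φ (k + 1) - (Real.exp (-(s ^ 2 * v / 2)) : ℂ) * φ k‖
        ≤ s ^ 2 * (A k + 4 * (A k + B s)) + s ^ 4 * v ^ 2 := fun k => by
      have := norm_integral_exp_add_sub_le (μ := μ) (S := fun ω => ∑ j ∈ Finset.range k, D j ω)
        (by fun_prop) (hD k) (hD2 k) hv (h0 k s) (h1 k s) (h2 k s)
      simpa only [hφ, Finset.sum_range_succ] using this
    have hφ0 : φ 0 = 1 := by simp [hφ]
    have hρ : ‖(Real.exp (-(s ^ 2 * v / 2)) : ℂ)‖ ≤ 1 := by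
      rw [Complex.norm_real, Real.norm_of_nonneg (Real.exp_pos _).le, Real.exp_le_one_iff]
      have : 0 ≤ s ^ 2 * v / 2 := by positivity
      linarith
    have htel := norm_sub_pow_le_sum hφ0 hρ hstep n
    have hcf : charFun (μ.map (fun ω => (√n)⁻¹ * ∑ k ∈ Finset.range n, D k ω)) t = φ n := by
      rw [charFun_apply_real, integral_map (by fun_prop) (by fun_prop)]
      refine integral_congr_ae (ae_of_all _ fun ω => ?_)
      simp only [hsdef]
      push_cast
      ring_nf
    have hpow : (Real.exp (-(s ^ 2 * v / 2)) : ℂ) ^ n =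
        Complex.exp (t * (0 : ℝ) * Complex.I - (v.toNNReal : ℝ) * t ^ 2 / 2) := by
      rw [← Complex.ofReal_pow, ← Real.exp_nat_mul, hs2, Real.coe_toNNReal _ hv, Complex.ofReal_exp]
      congr 1
      push_cast
      have : (n : ℂ) ≠ 0 := by exact_mod_cast hn0.ne'
      field_simp
      ring
    rw [hcf]
    rw [hpow] at htel
    refine htel.trans_eq ?_
    have hs4 : s ^ 4 = t ^ 4 * (n : ℝ)⁻¹ ^ 2 := by
      rw [show s ^ 4 = (s ^ 2) ^ 2 by ring, hs2]; ring
    rw [Finset.sum_add_distrib, ← Finset.mul_sum, Finset.sum_add_distrib, ← Finset.mul_sum,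
      Finset.sum_add_distrib]
    simp only [Finset.sum_const, Finset.card_range, nsmul_eq_mul]
    rw [hs4, hs2]
    field_simp
    ring

end MartingaleCLT

/-! ### Moments of the importance weighted evaluations. -/

section Increments

variable {d : ℕ} {Ω : Type*}

/-- The importance weighted evaluation `ψ(X_{k+1}) f(X_{k+1}) / q_k(X_{k+1})`. -/
def increment (f : E d → ℝ) (q : ℕ → Ω → E d → ℝ) (X : ℕ → Ω → E d) (ψ : E d → ℝ) (k : ℕ)
    (ω : Ω) : ℝ :=
  f (X (k + 1) ω) / q k ω (X (k + 1) ω) * ψ (X (k + 1) ω)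

/-- Domination forces a = 0 where p = 0, so division by zero does no harm. -/
theorem div_mul_cancel_of_le {a p b : ℝ} (ha : 0 ≤ a) (h : a ≤ b * p) : a / p * p = a :=
  div_mul_cancel_of_imp fun hp => le_antisymm (by simpa [hp] using h) ha

theorem div_le_of_le_mul_of_nonneg {a p b : ℝ} (hb : 0 ≤ b) (hp : 0 ≤ p) (h : a ≤ b * p) :
    a / p ≤ b :=
  div_le_of_le_mul₀ hp hb h

variable {X : ℕ → Ω → E d} {q : ℕ → Ω → E d → ℝ} {f ψ : E d → ℝ} {b : ℕ → ℝ}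

theorem history_mono (X : ℕ → Ω → E d) : Monotone (history X) := fun _ _ h =>
  biSup_mono fun _ hj => Finset.Icc_subset_Icc_right h hj

theorem measurable_history_succ (X : ℕ → Ω → E d) (k : ℕ) :
    Measurable[history X (k + 1)] (X (k + 1)) := by
  have h : MeasurableSpace.comap (X (k + 1)) inferInstance ≤ history X (k + 1) :=
    le_iSup₂_of_le (k + 1) (by simp) le_rfl
  exact (comap_measurable _).mono h le_rfl

variable [mΩ : MeasurableSpace Ω] {μ : Measure Ω}

namespace IsPolicy

theorem measurable_uncurry (hP : IsPolicy μ X q) (k : ℕ) : Measurable (Function.uncurry (q k)) :=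
  (hP.adapted k).mono (sup_le_sup_right (MeasurableSpace.comap_mono (hP.history_le k)) _) le_rfl

theorem measurable_increment_history (hP : IsPolicy μ X q) (hf : Measurable f) (hψ : Measurable ψ)
    (k : ℕ) : Measurable[history X (k + 1)] (increment f q X ψ k) := by
  have hX := measurable_history_succ X k
  have hid : @Measurable Ω Ω (history X (k + 1)) (history X k) id :=
    measurable_id'' (history_mono X k.le_succ)
  have hq : Measurable[history X (k + 1)] fun ω => q k ω (X (k + 1) ω) :=
    (hP.adapted k).comp
      (hid.prodMk hX)
  exact ((hf.comp hX).div hq).mul (hψ.comp hX)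

theorem measurable_increment (hP : IsPolicy μ X q) (hf : Measurable f) (hψ : Measurable ψ)
    (k : ℕ) : Measurable (increment f q X ψ k) :=
  (hP.measurable_increment_history hf hψ k).mono (hP.history_le _) le_rfl

theorem measurable_sum_increment_history (hP : IsPolicy μ X q) (hf : Measurable f)
    (hψ : Measurable ψ) (m : ℝ) (k : ℕ) :
    Measurable[history X k] fun ω => ∑ j ∈ Finset.range k, (increment f q X ψ j ω - m) :=
  Finset.measurable_sum _ fun j hj =>
    ((hP.measurable_increment_history hf hψ j).mono
      (history_mono X (Finset.mem_range.1 hj)) le_rfl).sub_const m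

theorem ratio_sq_mul (a p c : ℝ) :
    p * (a / p * c) ^ 2 = a ^ 2 / p * c ^ 2 := by
  rcases eq_or_ne p 0 with rfl | hp
  · simp
  · field_simp

theorem measurable_sq_div_mul (hP : IsPolicy μ X q) (k : ℕ)
    (hf : Measurable f) (hψ : Measurable ψ) :
    Measurable fun z : Ω × E d => f z.2 ^ 2 / q k z.1 z.2 * ψ z.2 ^ 2 := by
  have h1 := hP.measurable_uncurry k
  exact (((hf.comp measurable_snd).pow_const 2).div h1).mul ((hψ.comp measurable_snd).pow_const 2)

theorem sq_div_mul_le (hP : IsPolicy μ X q) {k : ℕ} (hbk : 0 ≤ b k) (hf0 : ∀ x, 0 ≤ f x)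
    (hb : ∀ ω y, f y ≤ b k * q k ω y) (ω : Ω) (y : E d) :
    f y ^ 2 / q k ω y ≤ b k * f y := by
  rw [sq, mul_div_assoc, mul_comm]
  exact mul_le_mul_of_nonneg_right
    (div_le_of_le_mul_of_nonneg hbk ((hP.pdf k ω).nonneg y) (hb ω y)) (hf0 y)

variable [IsProbabilityMeasure μ]

/-- The weight cancels the random density q_k, so the conditional mean is deterministic. The real
case gives orthogonality; the complex case serves characteristic functions. -/
theorem integral_mul_increment {𝕜 : Type*} [RCLike 𝕜] (hP : IsPolicy μ X q) (hf : Measurable f)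
    (hf0 : ∀ x, 0 ≤ f x) (hψ : Measurable ψ) {k : ℕ} (hb : ∀ ω y, f y ≤ b k * q k ω y) {Φ : Ω → 𝕜}
    (hΦ : Measurable[history X k] Φ) :
    ∫ ω, Φ ω * ((increment f q X ψ k ω : ℝ) : 𝕜) ∂μ = (∫ ω, Φ ω ∂μ) * ((∫ y, f y * ψ y : ℝ) : 𝕜) := by
  have hm : StronglyMeasurable[(history X k).prod inferInstance] fun z : Ω × E d =>
      Φ z.1 * ((f z.2 / q k z.1 z.2 * ψ z.2 : ℝ) : 𝕜) := by
    refine Measurable.stronglyMeasurable ?_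
    have h1 := hP.adapted k
    have h2 := hΦ.comp (@measurable_fst Ω (E d) (history X k) inferInstance)
    have h3 := hf.comp (@measurable_snd Ω (E d) (history X k) inferInstance)
    have h4 := hψ.comp (@measurable_snd Ω (E d) (history X k) inferInstance)
    exact h2.mul (RCLike.measurable_ofReal.comp ((h3.div h1).mul h4))
  rw [show ∫ ω, Φ ω * ((increment f q X ψ k ω : ℝ) : 𝕜) ∂μ = _ from hP.integral_next k hm,
    ← integral_ofReal, ← integral_prod_mul]
  refine integral_congr_ae (ae_of_all _ fun z => ?_)
  simp only [RCLike.real_smul_eq_coe_mul]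
  rw [mul_left_comm, ← RCLike.ofReal_mul]
  congr 2
  rw [← mul_assoc, mul_comm (q k z.1 z.2), div_mul_cancel_of_le (hf0 _) (hb _ _)]

theorem integral_increment (hP : IsPolicy μ X q) (hf : Measurable f)
    (hf0 : ∀ x, 0 ≤ f x) (hψ : Measurable ψ) {k : ℕ} (hb : ∀ ω y, f y ≤ b k * q k ω y) :
    ∫ ω, increment f q X ψ k ω ∂μ = ∫ y, f y * ψ y := by
  have := hP.integral_mul_increment (𝕜 := ℝ) hf hf0 hψ hb (Φ := fun _ => 1) measurable_const
  simpa using this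

section Square

variable {G : Type*} [NormedAddCommGroup G] [NormedSpace ℝ G]

/-- Second moments of the weighted evaluations. -/
theorem integral_increment_comp (hP : IsPolicy μ X q) (k : ℕ) {F : Ω × E d → G}
    (hF : StronglyMeasurable[(history X k).prod inferInstance] F)
    (hf : Measurable f) (hψ : Measurable ψ) :
    ∫ ω, increment f q X ψ k ω ^ 2 • F (ω, X (k + 1) ω) ∂μ =
      ∫ z, (f z.2 ^ 2 / q k z.1 z.2 * ψ z.2 ^ 2) • F z ∂(μ.prod volume) := by
  have hm : StronglyMeasurable[(history X k).prod inferInstance] fun z : Ω × E d =>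
      (f z.2 / q k z.1 z.2 * ψ z.2) ^ 2 • F z := by
    refine StronglyMeasurable.smul ?_ hF
    refine Measurable.stronglyMeasurable ?_
    have h1 := hP.adapted k
    have h3 := hf.comp (@measurable_snd Ω (E d) (history X k) inferInstance)
    have h4 := hψ.comp (@measurable_snd Ω (E d) (history X k) inferInstance)
    exact ((h3.div h1).mul h4).pow_const 2
  rw [show ∫ ω, increment f q X ψ k ω ^ 2 • F (ω, X (k + 1) ω) ∂μ = _ from hP.integral_next k hm]
  refine integral_congr_ae (ae_of_all _ fun z => ?_)
  simp only [smul_smul]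
  rw [ratio_sq_mul]

theorem integrable_sq_div_mul (hP : IsPolicy μ X q) (k : ℕ)
    (hf : Measurable f) (hf0 : ∀ x, 0 ≤ f x) (hψ : Measurable ψ) (hbk : 0 ≤ b k)
    (hb : ∀ ω y, f y ≤ b k * q k ω y) (hi : Integrable fun y => f y * ψ y ^ 2) :
    Integrable (fun z : Ω × E d => f z.2 ^ 2 / q k z.1 z.2 * ψ z.2 ^ 2) (μ.prod volume) := by
  refine ((hi.comp_snd μ).const_mul (b k)).mono'
    (hP.measurable_sq_div_mul k hf hψ).aestronglyMeasurable (ae_of_all _ fun z => ?_)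
  have h0 : 0 ≤ f z.2 ^ 2 / q k z.1 z.2 := div_nonneg (sq_nonneg _) ((hP.pdf k z.1).nonneg _)
  rw [Real.norm_of_nonneg (by positivity), ← mul_assoc]
  exact mul_le_mul_of_nonneg_right (hP.sq_div_mul_le hbk hf0 hb _ _) (sq_nonneg _)

theorem integrable_increment_sq (hP : IsPolicy μ X q) (k : ℕ)
    (hf : Measurable f) (hf0 : ∀ x, 0 ≤ f x) (hψ : Measurable ψ) (hbk : 0 ≤ b k)
    (hb : ∀ ω y, f y ≤ b k * q k ω y) (hi : Integrable fun y => f y * ψ y ^ 2) :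
    Integrable (fun ω => increment f q X ψ k ω ^ 2) μ := by
  have hm : StronglyMeasurable[(history X k).prod inferInstance] fun z : Ω × E d =>
      (f z.2 / q k z.1 z.2 * ψ z.2) ^ 2 := by
    refine Measurable.stronglyMeasurable ?_
    have h1 := hP.adapted k
    have h3 := hf.comp (@measurable_snd Ω (E d) (history X k) inferInstance)
    have h4 := hψ.comp (@measurable_snd Ω (E d) (history X k) inferInstance)
    exact ((h3.div h1).mul h4).pow_const 2
  refine (hP.integrable_next_iff k hm).2 ?_
  refine (hP.integrable_sq_div_mul k hf hf0 hψ hbk hb hi).congr (ae_of_all _ fun z => ?_)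
  simp only [smul_eq_mul]
  rw [ratio_sq_mul]

theorem integral_increment_sq_le (hP : IsPolicy μ X q) (k : ℕ)
    (hf : Measurable f) (hf0 : ∀ x, 0 ≤ f x) (hψ : Measurable ψ) (hbk : 0 ≤ b k)
    (hb : ∀ ω y, f y ≤ b k * q k ω y) (hi : Integrable fun y => f y * ψ y ^ 2) :
    ∫ ω, increment f q X ψ k ω ^ 2 ∂μ ≤ b k * ∫ y, f y * ψ y ^ 2 := by
  have h := hP.integral_increment_comp k (F := fun _ => (1 : ℝ)) stronglyMeasurable_const
    hf hψ
  simp only [smul_eq_mul, mul_one] at h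
  rw [h]
  calc _ ≤ ∫ z : Ω × E d, b k * (f z.2 * ψ z.2 ^ 2) ∂(μ.prod volume) := by
        refine integral_mono (hP.integrable_sq_div_mul k hf hf0 hψ hbk hb hi)
          ((hi.comp_snd μ).const_mul (b k)) fun z => ?_
        simp only [← mul_assoc]
        exact mul_le_mul_of_nonneg_right (hP.sq_div_mul_le hbk hf0 hb _ _) (sq_nonneg _)
    _ = _ := by
        rw [integral_const_mul, integral_fun_snd (fun y => f y * ψ y ^ 2)]
        simp

end Square

/-- Orthogonality of the centered weighted evaluations. -/
theorem integral_sum_increment_sq_le (hP : IsPolicy μ X q)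
    (hf : Measurable f) (hf0 : ∀ x, 0 ≤ f x) (hψ : Measurable ψ) (hb0 : ∀ k, 0 ≤ b k)
    (hb : ∀ k ω y, f y ≤ b k * q k ω y) (hi : Integrable fun y => f y * ψ y ^ 2) (n : ℕ) :
    Integrable (fun ω => (∑ k ∈ Finset.range n, (increment f q X ψ k ω - ∫ y, f y * ψ y)) ^ 2) μ ∧
    ∫ ω, (∑ k ∈ Finset.range n, (increment f q X ψ k ω - ∫ y, f y * ψ y)) ^ 2 ∂μ ≤
      (∑ k ∈ Finset.range n, b k) * ∫ y, f y * ψ y ^ 2 := by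
  set m := ∫ y, f y * ψ y with hm
  induction n with
  | zero => simp
  | succ n ih =>
    set M : Ω → ℝ := fun ω => ∑ k ∈ Finset.range n, (increment f q X ψ k ω - m) with hM
    set D : Ω → ℝ := increment f q X ψ n with hD
    have hMm' := hP.measurable_sum_increment_history hf hψ m n
    have hMm : Measurable M := hMm'.mono (hP.history_le n) le_rfl
    have hDm : Measurable D := hP.measurable_increment hf hψ n
    have hM2 : MemLp M 2 μ := (memLp_two_iff_integrable_sq hMm.aestronglyMeasurable).2 ih.1
    have hD2 : MemLp D 2 μ := (memLp_two_iff_integrable_sq hDm.aestronglyMeasurable).2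
      (hP.integrable_increment_sq n hf hf0 hψ (hb0 n) (hb n) hi)
    have hM1 : Integrable M μ := hM2.integrable (by norm_num)
    have hD1 : Integrable D μ := hD2.integrable (by norm_num)
    have hMD : Integrable (fun ω => M ω * D ω) μ := hM2.integrable_mul hD2
    -- After doubling, this cancels against −2m E[M], so E[M] need not be computed. Centering D
    -- leaves −m², which is dropped.
    have hMDe : ∫ ω, M ω * D ω ∂μ = (∫ ω, M ω ∂μ) * m :=
      hP.integral_mul_increment (𝕜 := ℝ) hf hf0 hψ (hb n) hMm'
    have hDe : ∫ ω, D ω ∂μ = m := hP.integral_increment hf hf0 hψ (hb n)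
    have e : ∀ ω, (∑ k ∈ Finset.range (n + 1), (increment f q X ψ k ω - m)) ^ 2 =
        M ω ^ 2 + (2 * (M ω * D ω) + ((-2 * m) * M ω + (D ω ^ 2 + ((-2 * m) * D ω + m ^ 2)))) := by
      intro ω
      rw [Finset.sum_range_succ]
      change (M ω + (D ω - m)) ^ 2 = _
      ring
    simp_rw [e]
    have j1 : Integrable (fun ω => (-2 * m) * D ω + m ^ 2) μ :=
      (hD1.const_mul _).add (integrable_const _)
    have j2 : Integrable (fun ω => D ω ^ 2 + ((-2 * m) * D ω + m ^ 2)) μ :=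
      hD2.integrable_sq.add j1
    have j3 : Integrable (fun ω => (-2 * m) * M ω + (D ω ^ 2 + ((-2 * m) * D ω + m ^ 2))) μ :=
      (hM1.const_mul _).add j2
    have j4 : Integrable (fun ω => 2 * (M ω * D ω) +
        ((-2 * m) * M ω + (D ω ^ 2 + ((-2 * m) * D ω + m ^ 2)))) μ := (hMD.const_mul 2).add j3
    refine ⟨ih.1.add j4, ?_⟩
    rw [integral_add ih.1 j4, integral_add (hMD.const_mul 2) j3, integral_add (hM1.const_mul _) j2,
      integral_add hD2.integrable_sq j1, integral_add (hD1.const_mul _) (integrable_const _),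
      integral_const_mul, integral_const_mul, integral_const_mul, hMDe, hDe,
      Finset.sum_range_succ, add_mul]
    have := hP.integral_increment_sq_le n hf hf0 hψ (hb0 n) (hb n) hi
    have h2 := ih.2
    simp only [integral_const, probReal_univ, one_smul]
    nlinarith [sq_nonneg m]

end IsPolicy

end Increments

/-! ### Bias and second moment of the rescaled kernel. -/

section Kernel

variable {d : ℕ}

/-- Mean value inequality twice: the derivative is C-Lipschitz, hence within C‖v‖ of its value at x
on the ball of radius ‖v‖. -/
theorem abs_sub_sub_fderiv_le {f : E d → ℝ} (hf : ContDiff ℝ 2 f) {C : ℝ}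
    (hC : ∀ x, ‖iteratedFDeriv ℝ 2 f x‖ ≤ C) (x v : E d) :
    |f (x + v) - f x - fderiv ℝ f x v| ≤ C * ‖v‖ ^ 2 := by
  have hd : Differentiable ℝ f := hf.differentiable (by norm_num)
  have hd1 : Differentiable ℝ (fderiv ℝ f) :=
    (hf.fderiv_right (m := 1) (by norm_num)).differentiable (by norm_num)
  have h2 : ∀ z, ‖fderiv ℝ (fderiv ℝ f) z‖ ≤ C := fun z => by
    rw [← norm_iteratedFDeriv_one, norm_iteratedFDeriv_fderiv]
    exact hC z
  have hC0 : 0 ≤ C := (norm_nonneg _).trans (hC x)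
  have h1 : ∀ z, ‖fderiv ℝ f z - fderiv ℝ f x‖ ≤ C * ‖z - x‖ := fun z =>
    convex_univ.norm_image_sub_le_of_norm_fderiv_le (𝕜 := ℝ) (fun w _ => hd1 w) (fun w _ => h2 w)
      (Set.mem_univ x) (Set.mem_univ z)
  have h := (convex_closedBall x ‖v‖).norm_image_sub_le_of_norm_fderiv_le' (𝕜 := ℝ) (f := f)
    (φ := fderiv ℝ f x) (C := C * ‖v‖) (x := x) (y := x + v) (fun w _ => hd w)
    (fun w hw => (h1 w).trans (by
      gcongr; simpa [dist_eq_norm] using hw)) (by simp) (by simp)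
  simp only [add_sub_cancel_left, Real.norm_eq_abs] at h
  exact h.trans_eq (by ring)

theorem H3.exists_bound {K : E d → ℝ} (hK : H3 K) : ∃ C, 0 < C ∧ ∀ x, K x ≤ C := by
  obtain ⟨C, r, hC, hr, h⟩ := hK.tail
  refine ⟨C, hC, fun x => (h x).trans (mul_le_of_le_one_right hC.le ?_)⟩
  exact Real.rpow_le_one_of_one_le_of_nonpos (by linarith [norm_nonneg x]) (by linarith)

theorem H2.exists_bound {f q₀ : E d → ℝ} (hq : H2 f q₀) : ∃ C, 0 < C ∧ ∀ x, q₀ x ≤ C := by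
  obtain ⟨C, r, hC, hr, h⟩ := hq.tail
  refine ⟨C, hC, fun x => (h x).trans (mul_le_of_le_one_right hC.le ?_)⟩
  exact Real.rpow_le_one_of_one_le_of_nonpos (by linarith [norm_nonneg x]) (by linarith)

variable {K : E d → ℝ}

theorem measurable_scaledKernel (hK : Measurable K) (h : ℝ) : Measurable (scaledKernel K h) :=
  (hK.comp (measurable_const_smul _)).div_const _

theorem scaledKernel_nonneg (hK : ∀ x, 0 ≤ K x) {h : ℝ} (hh : 0 < h) (u : E d) :
    0 ≤ scaledKernel K h u := div_nonneg (hK _) (by positivity)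

/-- Convolution with the rescaled kernel is an average over the unscaled kernel. -/
theorem integral_mul_scaledKernel (f : E d → ℝ) {h : ℝ} (hh : 0 < h) (x : E d) :
    ∫ y, f y * scaledKernel K h (x - y) = ∫ u, f (x - h • u) * K u := by
  rw [← integral_sub_left_eq_self (fun y => f y * scaledKernel K h (x - y)) volume x]
  have e : ∀ u : E d, f (x - u) * scaledKernel K h (x - (x - u)) =
      (h ^ d)⁻¹ * (fun v : E d => f (x - h • v) * K v) (h⁻¹ • u) := fun u => by
    simp only [sub_sub_cancel, scaledKernel, smul_smul, mul_inv_cancel₀ hh.ne', one_smul]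
    ring
  rw [integral_congr_ae (ae_of_all _ e), integral_const_mul,
    Measure.integral_comp_inv_smul_of_nonneg volume (fun v : E d => f (x - h • v) * K v) hh.le]
  simp only [finrank_euclideanSpace, Fintype.card_fin, smul_eq_mul]
  rw [← mul_assoc, inv_mul_cancel₀ (by positivity), one_mul]

theorem integral_scaledKernel (hK : IsPDF K) {h : ℝ} (hh : 0 < h) (x : E d) :
    ∫ y, scaledKernel K h (x - y) = 1 := by
  have := integral_mul_scaledKernel (K := K) (fun _ => 1) hh x
  simpa [hK.integral_eq_one] using this

theorem integrable_scaledKernel (hK : IsPDF K) {h : ℝ} (hh : 0 < h) (x : E d) :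
    Integrable fun y => scaledKernel K h (x - y) := by
  by_contra hc
  have := integral_scaledKernel hK hh x
  rw [integral_undef hc] at this
  exact zero_ne_one this

/-- Bound f by F and one kernel factor by C/h^d; the other factor integrates to 1. This is the
h^{-d} in the variance of the kernel estimate. -/
theorem integrable_mul_scaledKernel_sq (hK : IsPDF K) {C F : ℝ} (hC : ∀ x, K x ≤ C)
    {f : E d → ℝ} (hfm : Measurable f) (hf0 : ∀ x, 0 ≤ f x) (hF : ∀ x, f x ≤ F)
    {h : ℝ} (hh : 0 < h) (x : E d) :
    Integrable (fun y => f y * scaledKernel K h (x - y) ^ 2) ∧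
      ∫ y, f y * scaledKernel K h (x - y) ^ 2 ≤ F * C / h ^ d := by
  have hb : ∀ y, f y * scaledKernel K h (x - y) ^ 2 ≤
      F * C / h ^ d * scaledKernel K h (x - y) := fun y => by
    have h0 := scaledKernel_nonneg hK.nonneg hh (x - y)
    have h1 : scaledKernel K h (x - y) ≤ C / h ^ d := by
      unfold scaledKernel; gcongr; exact hC _
    calc f y * scaledKernel K h (x - y) ^ 2
        = (f y * scaledKernel K h (x - y)) * scaledKernel K h (x - y) := by ring
      _ ≤ (F * (C / h ^ d)) * scaledKernel K h (x - y) := by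
          have := hF y
          have := hf0 y
          gcongr
          linarith
      _ = _ := by ring
  have hi := (integrable_scaledKernel hK hh x).const_mul (F * C / h ^ d)
  have hI : Integrable (fun y => f y * scaledKernel K h (x - y) ^ 2) := by
    refine hi.mono' ?_ (ae_of_all _ fun y => ?_)
    · exact (hfm.mul (((measurable_scaledKernel hK.measurable h).comp
        (measurable_const.sub measurable_id)).pow_const 2)).aestronglyMeasurable
    · rw [Real.norm_of_nonneg (mul_nonneg (hf0 y) (sq_nonneg _))]
      exact hb y
  refine ⟨hI, (integral_mono hI hi hb).trans_eq ?_⟩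
  rw [integral_const_mul, integral_scaledKernel hK hh, mul_one]

/-- The bias of a kernel estimate with a centered kernel is quadratic in the bandwidth. -/
theorem H3.exists_bias_bound (hK : H3 K) {f : E d → ℝ} (hf : ContDiff ℝ 2 f) {C F : ℝ}
    (hC : ∀ x, ‖iteratedFDeriv ℝ 2 f x‖ ≤ C) (hF : ∀ x, |f x| ≤ F) :
    ∃ B, 0 ≤ B ∧ ∀ h x, 0 < h → |(∫ y, f y * scaledKernel K h (x - y)) - f x| ≤ B * h ^ 2 := by
  have hC0 : 0 ≤ C := (norm_nonneg _).trans (hC 0)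
  have hKi := hK.pdf.integrable
  have hu : Integrable fun u : E d => K u • u := by
    refine (hKi.add hK.second_moment).mono'
      (hK.pdf.measurable.smul measurable_id).aestronglyMeasurable (ae_of_all _ fun u => ?_)
    rw [norm_smul, Real.norm_of_nonneg (hK.pdf.nonneg u)]
    simp only [Pi.add_apply]
    nlinarith [mul_nonneg (hK.pdf.nonneg u) (sq_nonneg (‖u‖ - 1)),
      mul_nonneg (hK.pdf.nonneg u) (norm_nonneg u)]
  refine ⟨C * ∫ u, ‖u‖ ^ 2 * K u, mul_nonneg hC0 (integral_nonneg fun u =>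
    mul_nonneg (sq_nonneg _) (hK.pdf.nonneg u)), fun h x hh => ?_⟩
  rw [integral_mul_scaledKernel f hh]
  -- Centering of the kernel removes the first-order Taylor term.
  have hlin : ∫ u, fderiv ℝ f x (h • u) * K u = 0 := by
    have e : ∀ u : E d, fderiv ℝ f x (h • u) * K u = (h • fderiv ℝ f x) (K u • u) := fun u => by
      simp; ring
    simp_rw [e]
    rw [ContinuousLinearMap.integral_comp_comm _ hu, hK.centered, map_zero]
  have hlini : Integrable fun u => fderiv ℝ f x (h • u) * K u := by
    have e : ∀ u : E d, fderiv ℝ f x (h • u) * K u = (h • fderiv ℝ f x) (K u • u) := fun u => by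
      simp; ring
    simp_rw [e]
    exact ContinuousLinearMap.integrable_comp _ hu
  have hfi : Integrable fun u => f (x - h • u) * K u := by
    refine hKi.bdd_mul (c := F) ?_ (ae_of_all _ fun u => hF _)
    exact (hf.continuous.comp (by fun_prop)).aestronglyMeasurable
  have e : (∫ u, f (x - h • u) * K u) - f x =
      ∫ u, (f (x - h • u) * K u - f x * K u) + fderiv ℝ f x (h • u) * K u := by
    have hsub : Integrable fun u => f (x - h • u) * K u - f x * K u := hfi.sub (hKi.const_mul _)
    rw [integral_add hsub hlini, integral_sub hfi (hKi.const_mul _), hlin,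
      integral_const_mul, hK.pdf.integral_eq_one]
    ring
  rw [e, ← Real.norm_eq_abs]
  refine (norm_integral_le_of_norm_le ((hK.second_moment).const_mul (C * h ^ 2))
    (ae_of_all _ fun u => ?_)).trans_eq ?_
  · have := abs_sub_sub_fderiv_le hf hC x (-(h • u))
    rw [← sub_eq_add_neg, map_neg, norm_neg, norm_smul, Real.norm_of_nonneg hh.le] at this
    rw [← sub_mul, ← add_mul, norm_mul, Real.norm_of_nonneg (hK.pdf.nonneg u), Real.norm_eq_abs]
    rw [sub_neg_eq_add] at this
    calc _ ≤ C * (h * ‖u‖) ^ 2 * K u := by gcongr; exact hK.pdf.nonneg u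
      _ = _ := by ring
  · rw [integral_const_mul]; ring

end Kernel

/-! ### Normalized estimates as ratios of averages. -/

section Weights

variable {d : ℕ} {Ω : Type*} {fU : E d → ℝ} {q : ℕ → E d → ℝ} {x : ℕ → E d}

theorem IsUnnormalizedTarget.eq_mul_target (hfU : IsUnnormalizedTarget fU) (y : E d) :
    fU y = (∫ z, fU z) * target fU y :=
  (mul_div_cancel₀ _ hfU.integral_pos.ne').symm

theorem IsUnnormalizedTarget.isPDF_target (hfU : IsUnnormalizedTarget fU) : IsPDF (target fU) where
  measurable := hfU.measurable.div_const _
  nonneg y := div_nonneg (hfU.nonneg y) hfU.integral_pos.le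
  integral_eq_one := by
    unfold target
    rw [integral_div, div_self hfU.integral_pos.ne']

theorem normWeight_nonneg (hfU : ∀ y, 0 ≤ fU y) (hq : ∀ k y, 0 ≤ q k y) (n k : ℕ) :
    0 ≤ normWeight fU q x n k := by
  have hw : ∀ j, 0 ≤ weight fU q x j := fun j => div_nonneg (hfU _) (hq _ _)
  unfold normWeight
  split_ifs
  · positivity
  · exact div_nonneg (hw k) (Finset.sum_nonneg fun j _ => hw j)

theorem kernelEstimate_nonneg (hfU : ∀ y, 0 ≤ fU y) (hq : ∀ k y, 0 ≤ q k y) {K : E d → ℝ}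
    (hK : ∀ y, 0 ≤ K y) {h : ℕ → ℝ} {n : ℕ} (hh : 0 < h n) (y : E d) :
    0 ≤ kernelEstimate fU q x K h n y :=
  Finset.sum_nonneg fun _ _ =>
    mul_nonneg (normWeight_nonneg hfU hq _ _) (scaledKernel_nonneg hK hh _)

theorem sum_Icc_one_eq_sum_range {M : Type*} [AddCommMonoid M] (a : ℕ → M) (n : ℕ) :
    ∑ k ∈ Finset.Icc 1 n, a k = ∑ k ∈ Finset.range n, a (k + 1) := by
  induction n with
  | zero => simp
  | succ n ih => rw [Finset.sum_Icc_succ_top (by omega), Finset.sum_range_succ, ih]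

/-- Normalized averages are ratios of sums of weighted evaluations. -/
theorem sum_normWeight_mul (hfU : IsUnnormalizedTarget fU) (q : ℕ → Ω → E d → ℝ)
    (X : ℕ → Ω → E d) (ψ : E d → ℝ) (n : ℕ) (ω : Ω)
    (hS : ∑ k ∈ Finset.range n, increment (target fU) q X (fun _ => 1) k ω ≠ 0) :
    ∑ k ∈ Finset.Icc 1 n, normWeight fU (fun j => q j ω) (fun j => X j ω) n k * ψ (X k ω) =
      (∑ k ∈ Finset.range n, increment (target fU) q X ψ k ω) /
        ∑ k ∈ Finset.range n, increment (target fU) q X (fun _ => 1) k ω := by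
  have hw : ∀ k, weight fU (fun j => q j ω) (fun j => X j ω) (k + 1) =
      (∫ z, fU z) * increment (target fU) q X (fun _ => 1) k ω := fun k => by
    simp only [weight, increment, Nat.add_sub_cancel, mul_one]
    rw [hfU.eq_mul_target, mul_div_assoc]
  have hsum : ∑ j ∈ Finset.Icc 1 n, weight fU (fun j => q j ω) (fun j => X j ω) j =
      (∫ z, fU z) * ∑ k ∈ Finset.range n, increment (target fU) q X (fun _ => 1) k ω := by
    rw [sum_Icc_one_eq_sum_range, Finset.mul_sum]
    exact Finset.sum_congr rfl fun k _ => hw k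
  have hne : (∫ z, fU z) ≠ 0 := hfU.integral_pos.ne'
  rw [sum_Icc_one_eq_sum_range, Finset.sum_div]
  refine Finset.sum_congr rfl fun k _ => ?_
  rw [normWeight, hsum, if_neg (mul_ne_zero hne hS), hw, mul_div_mul_left _ _ hne]
  simp only [increment, mul_one]
  ring

/-- The normalized estimates and the averages of centered weighted evaluations. -/
theorem sqrt_mul_estimate_sub (hfU : IsUnnormalizedTarget fU) (q : ℕ → Ω → E d → ℝ)
    (X : ℕ → Ω → E d) (g : E d → ℝ) {n : ℕ} (hn : 1 ≤ n) (m : ℝ) (ω : Ω)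
    (hne : (∑ k ∈ Finset.range n, increment (target fU) q X (fun _ => 1) k ω) / n ≠ 0) :
    √(n : ℝ) * (estimate fU (fun j => q j ω) (fun j => X j ω) g n - m) =
      (√n)⁻¹ * (∑ k ∈ Finset.range n, increment (target fU) q X (fun y => g y - m) k ω) /
        ((∑ k ∈ Finset.range n, increment (target fU) q X (fun _ => 1) k ω) / n) := by
  have hn0 : (0 : ℝ) < n := by exact_mod_cast hn
  have hne' : ∑ k ∈ Finset.range n, increment (target fU) q X (fun _ => 1) k ω ≠ 0 := fun h0 =>
    hne (by rw [h0, zero_div])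
  have e1 : ∑ k ∈ Finset.range n, increment (target fU) q X (fun y => g y - m) k ω =
      ∑ k ∈ Finset.range n, increment (target fU) q X g k ω -
        m * ∑ k ∈ Finset.range n, increment (target fU) q X (fun _ => 1) k ω := by
    rw [Finset.mul_sum, ← Finset.sum_sub_distrib]
    refine Finset.sum_congr rfl fun k _ => ?_
    simp only [increment]
    ring
  rw [estimate, sum_normWeight_mul hfU q X g n ω hne', e1]
  set S := ∑ k ∈ Finset.range n, increment (target fU) q X (fun _ => 1) k ω
  have hs : √(n : ℝ) ≠ 0 := by positivity
  have hs2 : √(n : ℝ) ^ 2 = n := Real.sq_sqrt hn0.le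
  field_simp
  rw [hs2]
  ring

end Weights

/-- Chebyshev's inequality in pointwise form. Here S is the average weight, N the numerator of the
kernel estimate F, Nb the mean of N, L = λ_n and Q the policy. If S is within δ of 1 and N within δf
of f, then Q is comparable to f; otherwise the squares sum to at least 1 and the crude bound U + f
applies. The case S = 0, with its uniform weights, is exceptional because δ < 1, so F = N/S is
needed only for S ≠ 0. -/
theorem abs_sq_div_sub_le {f q₀ L δ S N Nb F Q U : ℝ} (hf : 0 < f) (hq₀ : 0 ≤ q₀) (hL : 0 < L)
    (hL2 : L ≤ 1 / 2) (hδ : 0 < δ) (hδ8 : δ ≤ 1 / 8) (hF : S ≠ 0 → F = N / S)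
    (hNb : |Nb - f| ≤ δ / 2 * f) (hQ : Q = (1 - L) * F + L * q₀) (hQ0 : 0 ≤ f ^ 2 / Q)
    (hU : f ^ 2 / Q ≤ U) :
    |f ^ 2 / Q - f| ≤ 16 * δ * f + 4 * L * (2 * f + q₀) +
      (U + f) * (((S - 1) / δ) ^ 2 + (2 * (N - Nb) / (δ * f)) ^ 2) := by
  have hU0 : 0 ≤ U := hQ0.trans hU
  have hmain : 0 ≤ 16 * δ * f + 4 * L * (2 * f + q₀) := by positivity
  have hbad : 1 ≤ ((S - 1) / δ) ^ 2 + (2 * (N - Nb) / (δ * f)) ^ 2 →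
      |f ^ 2 / Q - f| ≤ 16 * δ * f + 4 * L * (2 * f + q₀) +
      (U + f) * (((S - 1) / δ) ^ 2 + (2 * (N - Nb) / (δ * f)) ^ 2) := fun h => by
    have h1 : |f ^ 2 / Q - f| ≤ U + f := by rw [abs_le]; constructor <;> linarith
    nlinarith [mul_le_mul_of_nonneg_left h (by positivity : 0 ≤ U + f)]
  by_cases hS : δ < |S - 1|
  · apply hbad
    have : 1 ≤ ((S - 1) / δ) ^ 2 := by
      rw [one_le_sq_iff_one_le_abs, abs_div, abs_of_pos hδ, one_le_div hδ]; exact hS.le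
    nlinarith [sq_nonneg (2 * (N - Nb) / (δ * f))]
  by_cases hN : δ * f < |N - f|
  · apply hbad
    have : 1 ≤ (2 * (N - Nb) / (δ * f)) ^ 2 := by
      rw [one_le_sq_iff_one_le_abs, abs_div, abs_of_pos (by positivity : 0 < δ * f),
        one_le_div (by positivity), abs_mul, abs_of_pos (by norm_num : (0 : ℝ) < 2)]
      -- The bias uses up at most δf/2 of the deviation δf, which leaves δf/2 to N − Nb; hence the
      -- factor 2.
      have := abs_sub_le N Nb f
      linarith
    nlinarith [sq_nonneg ((S - 1) / δ)]
  push Not at hS hN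
  rw [abs_le] at hS hN
  have hS0 : 1 / 2 ≤ S := by linarith
  have hSpos : 0 < S := by linarith
  have hFN : F * S = N := by rw [hF hSpos.ne']; field_simp
  have hFf : |F - f| ≤ 4 * δ * f := by
    have h1 : |F - f| * S ≤ 2 * δ * f := by
      rw [← abs_of_pos hSpos, ← abs_mul, sub_mul, hFN, abs_le]
      constructor <;> nlinarith
    nlinarith [abs_nonneg (F - f)]
  have hFf' := abs_le.1 hFf
  have hF2 : f / 2 ≤ F := by nlinarith
  have hF3 : F ≤ 2 * f := by nlinarith
  have hQ4 : f / 4 ≤ Q := by rw [hQ]; nlinarith [mul_nonneg hL.le hq₀]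
  have hQpos : 0 < Q := by linarith
  have hQf : |f - Q| ≤ 4 * δ * f + L * (2 * f + q₀) := by
    rw [hQ, abs_le]
    constructor <;> nlinarith [mul_nonneg hL.le hq₀, mul_nonneg hL.le (by linarith : 0 ≤ F)]
  have he : f ^ 2 / Q - f = f / Q * (f - Q) := by field_simp
  have h4 : f / Q ≤ 4 := by rw [div_le_iff₀ hQpos]; linarith
  have hgood : |f ^ 2 / Q - f| ≤ 16 * δ * f + 4 * L * (2 * f + q₀) := by
    rw [he, abs_mul, abs_of_pos (by positivity : 0 < f / Q)]
    calc f / Q * |f - Q| ≤ 4 * (4 * δ * f + L * (2 * f + q₀)) := by gcongr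
      _ = _ := by ring
  have : 0 ≤ (U + f) * (((S - 1) / δ) ^ 2 + (2 * (N - Nb) / (δ * f)) ^ 2) := by positivity
  linarith

/-! ### Domination by the policy and mean square errors. -/

section Policy

variable {d : ℕ} {Ω : Type*} [MeasurableSpace Ω] {μ : Measure Ω}
  {fU q₀ K : E d → ℝ} {lam h : ℕ → ℝ} {X : ℕ → Ω → E d} {q : ℕ → Ω → E d → ℝ}

/-- The constants `b_k` with `f ≤ b_k q_k`, given `f ≤ c q₀`. -/
def dominance (c : ℝ) (lam : ℕ → ℝ) (k : ℕ) : ℝ := if k = 0 then c else c / lam k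

namespace IsStandardSAIS

theorem mul_le_policy (hS : IsStandardSAIS μ fU q₀ K lam h X q) (hfU : ∀ y, 0 ≤ fU y)
    (hK : ∀ y, 0 ≤ K y) {k : ℕ} (hk : 1 ≤ k) (hh : 0 < h k) (hlam : lam k ≤ 1) (ω : Ω) (y : E d) :
    lam k * q₀ y ≤ q k ω y := by
  rw [hS.update k hk]
  have := kernelEstimate_nonneg (x := fun j => X j ω) hfU
    (fun j y => (hS.policy.pdf j ω).nonneg y) hK hh y
  nlinarith [mul_nonneg (sub_nonneg.2 hlam) this]

theorem le_dominance_mul (hS : IsStandardSAIS μ fU q₀ K lam h X q) (hfU : ∀ y, 0 ≤ fU y)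
    (hK : ∀ y, 0 ≤ K y) (hh : ∀ k, 1 ≤ k → 0 < h k) (hlam : ∀ k, 1 ≤ k → 0 < lam k ∧ lam k ≤ 1)
    {f : E d → ℝ} {c : ℝ} (hc : 0 < c) (hf : ∀ y, f y ≤ c * q₀ y) (k : ℕ) (ω : Ω) (y : E d) :
    f y ≤ dominance c lam k * q k ω y := by
  unfold dominance
  split_ifs with hk
  · rw [hk, hS.init]; exact hf y
  · have hk1 : 1 ≤ k := Nat.one_le_iff_ne_zero.2 hk
    have h1 := hS.mul_le_policy hfU hK hk1 (hh k hk1) (hlam k hk1).2 ω y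
    have h0 := (hlam k hk1).1
    calc f y ≤ c / lam k * (lam k * q₀ y) := by
          rw [← mul_assoc, div_mul_cancel₀ _ h0.ne']; exact hf y
      _ ≤ _ := by gcongr

end IsStandardSAIS

theorem dominance_nonneg {c : ℝ} (hc : 0 ≤ c) (hlam : ∀ k, 1 ≤ k → 0 < lam k ∧ lam k ≤ 1) (k : ℕ) :
    0 ≤ dominance c lam k := by
  unfold dominance
  split_ifs with hk
  · exact hc
  · exact div_nonneg hc (hlam k (Nat.one_le_iff_ne_zero.2 hk)).1.le

theorem sum_dominance_le {c : ℝ} (hc : 0 ≤ c) (hlam : ∀ k, 1 ≤ k → 0 < lam k ∧ lam k ≤ 1)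
    (hanti : AntitoneOn lam (Set.Ici 1)) {n : ℕ} (hn : 1 ≤ n) :
    ∑ k ∈ Finset.range n, dominance c lam k ≤ n * (c / lam n) := by
  have hl := hlam n hn
  refine (Finset.sum_le_card_nsmul _ _ (c / lam n) fun k hk => ?_).trans_eq (by simp)
  unfold dominance
  split_ifs with h0
  -- The first draw comes from q₀ itself, with constant c ≤ c/λ_n because λ_n ≤ 1.
  · rw [le_div_iff₀ hl.1]; nlinarith [hl.2]
  · have hk1 : 1 ≤ k := Nat.one_le_iff_ne_zero.2 h0
    exact div_le_div_of_nonneg_left hc hl.1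
      (hanti (Set.mem_Ici.2 hk1) (Set.mem_Ici.2 hn) (Finset.mem_range.1 hk).le)

variable [IsProbabilityMeasure μ]

namespace IsStandardSAIS

/-- Mean square error of unnormalized importance sampling averages. -/
theorem integral_average_sub_sq_le (hS : IsStandardSAIS μ fU q₀ K lam h X q)
    (hfU : IsUnnormalizedTarget fU) (hK : ∀ y, 0 ≤ K y)
    (hh : ∀ k, 1 ≤ k → 0 < h k) (hlam : ∀ k, 1 ≤ k → 0 < lam k ∧ lam k ≤ 1)
    (hanti : AntitoneOn lam (Set.Ici 1)) {c : ℝ} (hc : 0 < c)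
    (hf : ∀ y, target fU y ≤ c * q₀ y) {ψ : E d → ℝ} (hψ : Measurable ψ)
    (hi : Integrable fun y => target fU y * ψ y ^ 2) {n : ℕ} (hn : 1 ≤ n) :
    Integrable (fun ω => ((∑ k ∈ Finset.range n, increment (target fU) q X ψ k ω) / n
      - ∫ y, target fU y * ψ y) ^ 2) μ ∧
    ∫ ω, ((∑ k ∈ Finset.range n, increment (target fU) q X ψ k ω) / n
      - ∫ y, target fU y * ψ y) ^ 2 ∂μ ≤ c / (n * lam n) * ∫ y, target fU y * ψ y ^ 2 := by
  have hp := hfU.isPDF_target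
  have key := hS.policy.integral_sum_increment_sq_le hp.measurable hp.nonneg hψ
    (dominance_nonneg hc.le hlam) (hS.le_dominance_mul hfU.nonneg hK hh hlam hc hf) hi n
  have hn0 : (0 : ℝ) < n := by exact_mod_cast hn
  have e : ∀ ω, ((∑ k ∈ Finset.range n, increment (target fU) q X ψ k ω) / n
      - ∫ y, target fU y * ψ y) ^ 2 = ((n : ℝ) ^ 2)⁻¹ *
      (∑ k ∈ Finset.range n, (increment (target fU) q X ψ k ω - ∫ y, target fU y * ψ y)) ^ 2 := by
    intro ω
    rw [Finset.sum_sub_distrib]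
    simp only [Finset.sum_const, Finset.card_range, nsmul_eq_mul]
    field_simp
  simp_rw [e]
  refine ⟨key.1.const_mul _, ?_⟩
  rw [integral_const_mul]
  have hl := (hlam n hn).1
  have h0 : 0 ≤ ∫ y, target fU y * ψ y ^ 2 :=
    integral_nonneg fun y => mul_nonneg (hp.nonneg y) (sq_nonneg _)
  calc _ ≤ ((n : ℝ) ^ 2)⁻¹ * (n * (c / lam n) * ∫ y, target fU y * ψ y ^ 2) := by
        gcongr
        exact key.2.trans (by gcongr; exact sum_dominance_le hc.le hlam hanti hn)
    _ = _ := by field_simp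

/-- Expectation of `abs_sq_div_sub_le`: the mean square errors of S and N are at most c/(nλ_n) and
cFC/(nλ_n h_n^d). The bound q_n ≥ λ_n q₀ makes U deterministic. -/
theorem integral_abs_sq_div_sub_le (hS : IsStandardSAIS μ fU q₀ K lam h X q)
    (hfU : IsUnnormalizedTarget fU) (hq₀ : ∀ y, 0 ≤ q₀ y) (hK : IsPDF K)
    (hh : ∀ k, 1 ≤ k → 0 < h k) (hlam : ∀ k, 1 ≤ k → 0 < lam k ∧ lam k ≤ 1)
    (hanti : AntitoneOn lam (Set.Ici 1)) {c F C B : ℝ} (hc : 0 < c)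
    (hf : ∀ y, target fU y ≤ c * q₀ y) (hF : ∀ y, target fU y ≤ F) (hC : ∀ y, K y ≤ C)
    (hB : ∀ h x, 0 < h →
      |(∫ y, target fU y * scaledKernel K h (x - y)) - target fU x| ≤ B * h ^ 2)
    {n : ℕ} (hn : 1 ≤ n) (hL2 : lam n ≤ 1 / 2) {δ : ℝ} (hδ : 0 < δ) (hδ8 : δ ≤ 1 / 8) {x : E d}
    (hfx : 0 < target fU x) (hbias : B * h n ^ 2 ≤ δ / 2 * target fU x) {U : ℝ}
    (hU : target fU x ^ 2 / (lam n * q₀ x) ≤ U) :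
    ∫ ω, |target fU x ^ 2 / q n ω x - target fU x| ∂μ ≤
      16 * δ * target fU x + 4 * lam n * (2 * target fU x + q₀ x) +
      (U + target fU x) * (c / (n * lam n * δ ^ 2) +
        4 * (c * F * C) / (n * h n ^ d * lam n * δ ^ 2 * target fU x ^ 2)) := by
  set f := target fU with hfdef
  have hp : IsPDF f := hfU.isPDF_target
  have hl := (hlam n hn).1
  have hhn := hh n hn
  have hn0 : (0 : ℝ) < n := by exact_mod_cast hn
  have hq0x : 0 < q₀ x := by
    by_contra hc'
    have := hf x
    nlinarith [hq₀ x]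
  have hU0 : 0 ≤ U := le_trans (by positivity) hU
  set ψ : E d → ℝ := fun y => scaledKernel K (h n) (x - y) with hψdef
  have hψ : Measurable ψ := (measurable_scaledKernel hK.measurable _).comp
    (measurable_const.sub measurable_id)
  have hψi := integrable_mul_scaledKernel_sq hK hC hp.measurable hp.nonneg hF hhn x
  have h1i : Integrable fun y => f y * (fun _ => (1 : ℝ)) y ^ 2 := by simpa using hp.integrable
  have m1 := hS.integral_average_sub_sq_le hfU hK.nonneg hh hlam hanti hc hf
    (measurable_const (a := (1 : ℝ))) h1i hn
  have m2 := hS.integral_average_sub_sq_le hfU hK.nonneg hh hlam hanti hc hf hψ hψi.1 hn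
  rw [← hfdef] at m1 m2
  simp only [mul_one, one_pow, hp.integral_eq_one] at m1
  set S : Ω → ℝ := fun ω => (∑ k ∈ Finset.range n, increment f q X (fun _ => 1) k ω) / n with hSdef
  set N : Ω → ℝ := fun ω => (∑ k ∈ Finset.range n, increment f q X ψ k ω) / n with hNdef
  set Nb := ∫ y, f y * ψ y with hNb
  have hpt : ∀ ω, |f x ^ 2 / q n ω x - f x| ≤ 16 * δ * f x + 4 * lam n * (2 * f x + q₀ x) +
      ((U + f x) / δ ^ 2 * (S ω - 1) ^ 2 + 4 * (U + f x) / (δ * f x) ^ 2 * (N ω - Nb) ^ 2) := by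
    intro ω
    have hql := hS.mul_le_policy hfU.nonneg hK.nonneg hn hhn (hlam n hn).2 ω x
    have := abs_sq_div_sub_le (S := S ω) (N := N ω) (Nb := Nb)
      (F := kernelEstimate fU (fun j => q j ω) (fun j => X j ω) K h n x)
      (U := U) hfx (hq₀ x) hl hL2 hδ hδ8 ?_ ?_ (hS.update n hn ω x)
      (div_nonneg (sq_nonneg _) ((hS.policy.pdf n ω).nonneg x)) (le_trans (by gcongr) hU)
    · refine this.trans_eq ?_
      congr 1
      field_simp
      ring
    · intro hS0
      have hS0' : ∑ k ∈ Finset.range n, increment f q X (fun _ => 1) k ω ≠ 0 := fun h0 =>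
        hS0 (by simp only [hSdef, h0, zero_div])
      have := sum_normWeight_mul hfU q X ψ n ω hS0'
      simp only [hSdef, hNdef, hfdef]
      rw [div_div_div_cancel_right₀ hn0.ne', ← this]
      rfl
    · exact (hB _ x hhn).trans hbias
  have i1 := (m1.1.const_mul ((U + f x) / δ ^ 2))
  have i2 := (m2.1.const_mul (4 * (U + f x) / (δ * f x) ^ 2))
  have i12 : Integrable (fun ω => (U + f x) / δ ^ 2 * (S ω - 1) ^ 2 +
    4 * (U + f x) / (δ * f x) ^ 2 * (N ω - Nb) ^ 2) μ := i1.add i2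
  refine (integral_mono_of_nonneg (ae_of_all _ fun ω => abs_nonneg _)
    ((integrable_const _).add i12) (ae_of_all _ hpt)).trans ?_
  simp only [Pi.add_apply]
  rw [integral_add (integrable_const _) i12, integral_add i1 i2, integral_const_mul,
    integral_const_mul]
  simp only [integral_const, probReal_univ, one_smul]
  have hF0 : 0 < F := hfx.trans_le (hF x)
  have hm2 : ∫ ω, (N ω - Nb) ^ 2 ∂μ ≤ c / (n * lam n) * (F * C / h n ^ d) :=
    m2.2.trans (by gcongr; exact hψi.2)
  calc _ ≤ 16 * δ * f x + 4 * lam n * (2 * f x + q₀ x) + ((U + f x) / δ ^ 2 * (c / (n * lam n)) +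
        4 * (U + f x) / (δ * f x) ^ 2 * (c / (n * lam n) * (F * C / h n ^ d))) := by
        gcongr
        exact m1.2
    _ = _ := by field_simp

end IsStandardSAIS

end Policy

/-! ### Powers of the target and consequences of the rate condition. -/

section Rates

variable {L ε f q₀ a : ℝ}

theorem rpow_mul_rpow_compl (hε : 0 < ε) (hf : 0 < f) :
    f ^ (1 / (1 + ε)) * f ^ (ε / (1 + ε)) = f := by
  rw [← Real.rpow_add hf]
  have : 1 / (1 + ε) + ε / (1 + ε) = 1 := by field_simp
  rw [this, Real.rpow_one]

/-- Write f = f^{1/(1+ε)} · f^{ε/(1+ε)}. The threshold L^{(1+ε)/2} is exactly where the first factor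
equals √L. -/
theorem sq_le_mul_sq_rpow (hL : 0 < L) (hε : 0 < ε) (hf : 0 < f) (hfL : f ≤ L ^ ((1 + ε) / 2)) :
    f ^ 2 ≤ L * (f ^ (ε / (1 + ε))) ^ 2 := by
  have h1 : (f ^ (1 / (1 + ε))) ^ 2 ≤ L := by
    have : f ^ (1 / (1 + ε)) ≤ L ^ (1 / 2 : ℝ) := by
      refine (Real.rpow_le_rpow hf.le hfL (by positivity)).trans_eq ?_
      rw [← Real.rpow_mul hL.le]; congr 1; field_simp
    calc (f ^ (1 / (1 + ε))) ^ 2 ≤ (L ^ (1 / 2 : ℝ)) ^ 2 := by gcongr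
      _ = L := by rw [← Real.rpow_natCast, ← Real.rpow_mul hL.le]; norm_num
  calc f ^ 2 = (f ^ (1 / (1 + ε)) * f ^ (ε / (1 + ε))) ^ 2 := by rw [rpow_mul_rpow_compl hε hf]
    _ = (f ^ (1 / (1 + ε))) ^ 2 * (f ^ (ε / (1 + ε))) ^ 2 := by ring
    _ ≤ _ := by gcongr

theorem mul_rpow_le_self (hL : 0 < L) (hL1 : L ≤ 1) (hε : 0 < ε) (hf : 0 < f)
    (hfL : L ^ ((1 + ε) / 2) ≤ f) : L * f ^ (ε / (1 + ε)) ≤ f := by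
  have h1 : L ≤ f ^ (1 / (1 + ε)) := by
    have h2 : L ^ (1 / 2 : ℝ) ≤ f ^ (1 / (1 + ε)) := by
      refine Eq.trans_le ?_ (Real.rpow_le_rpow (by positivity) hfL (by positivity))
      rw [← Real.rpow_mul hL.le]; congr 1; field_simp
    refine le_trans ?_ h2
    calc L = L ^ (1 : ℝ) := (Real.rpow_one L).symm
      _ ≤ _ := Real.rpow_le_rpow_of_exponent_ge hL hL1 (by norm_num)
  calc L * f ^ (ε / (1 + ε)) ≤ f ^ (1 / (1 + ε)) * f ^ (ε / (1 + ε)) := by gcongr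
    _ = f := rpow_mul_rpow_compl hε hf

theorem rpow_le_sq_rpow (hL : 0 < L) (hε : 0 < ε) (hfL : L ^ ((1 + ε) / 2) ≤ f) :
    L ^ ε ≤ (f ^ (ε / (1 + ε))) ^ 2 := by
  have h : L ^ (ε / 2) ≤ f ^ (ε / (1 + ε)) := by
    refine Eq.trans_le ?_ (Real.rpow_le_rpow (by positivity) hfL (by positivity))
    rw [← Real.rpow_mul hL.le]; congr 1; field_simp
  calc L ^ ε = (L ^ (ε / 2)) ^ 2 := by
        rw [← Real.rpow_natCast, ← Real.rpow_mul hL.le]; congr 1; push_cast; ring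
    _ ≤ _ := by gcongr

/-- Trades 1/q₀ for a negative power of f; the right-hand side is the `U` used above the threshold.
-/
theorem sq_div_mul_le_of_rpow_le (hL : 0 < L) (hf : 0 < f) (hq₀ : 0 < q₀)
    (hp : f ^ (ε / (1 + ε)) ≤ a * q₀) :
    f ^ 2 / (L * q₀) ≤ a * f ^ 2 / (L * f ^ (ε / (1 + ε))) := by
  have hp0 : 0 < f ^ (ε / (1 + ε)) := Real.rpow_pos_of_pos hf _
  rw [div_le_div_iff₀ (by positivity) (by positivity)]
  calc f ^ 2 * (L * f ^ (ε / (1 + ε))) = f ^ 2 * L * f ^ (ε / (1 + ε)) := by ring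
    _ ≤ f ^ 2 * L * (a * q₀) := by gcongr
    _ = _ := by ring

theorem sq_div_mul_le_of_le_rpow (hL : 0 < L) (hε : 0 < ε) (hf : 0 < f)
    (hfL : f ≤ L ^ ((1 + ε) / 2)) (hq₀ : 0 < q₀) (ha : 0 < a) (hp : f ^ (ε / (1 + ε)) ≤ a * q₀) :
    f ^ 2 / (L * q₀) ≤ a ^ 2 * q₀ := by
  have hp0 : 0 < f ^ (ε / (1 + ε)) := Real.rpow_pos_of_pos hf _
  have hsq := sq_le_mul_sq_rpow hL hε hf hfL
  refine (sq_div_mul_le_of_rpow_le hL hf hq₀ hp).trans ?_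
  calc _ ≤ a * (L * (f ^ (ε / (1 + ε))) ^ 2) / (L * f ^ (ε / (1 + ε))) := by gcongr
    _ = a * f ^ (ε / (1 + ε)) := by field_simp
    _ ≤ a * (a * q₀) := by gcongr
    _ = _ := by ring

/-- Cost of the exceptional event above the threshold, with r₁ = 1/n and r₂ = 1/(n h_n^d). The f² in
U cancels the f² in Chebyshev's denominator. With p = f^{ε/(1+ε)} and m = L^ε there remains m ·
(m/p), and m ≤ p² gives m/p ≤ p ≤ a q₀. -/
theorem deviation_term_le {c F C δ r₁ r₂ : ℝ} (hL : 0 < L) (hL1 : L ≤ 1) (hε : 0 < ε) (hf : 0 < f)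
    (hfL : L ^ ((1 + ε) / 2) ≤ f) (hfF : f ≤ F) (ha : 0 < a) (hp : f ^ (ε / (1 + ε)) ≤ a * q₀)
    (hc : 0 < c) (hC : 0 ≤ C) (hδ : 0 < δ) (hr₁ : r₁ ≤ L ^ (2 + 2 * ε)) (hr₂ : r₂ ≤ L ^ (2 + 2 * ε)) :
    (a * f ^ 2 / (L * f ^ (ε / (1 + ε))) + f) *
      (c * r₁ / (L * δ ^ 2) + 4 * (c * F * C) * r₂ / (L * δ ^ 2 * f ^ 2)) ≤
      (a + 1) * a / δ ^ 2 * (c * F ^ 2 + 4 * (c * F * C)) * L ^ ε * q₀ := by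
  have h1 := mul_rpow_le_self hL hL1 hε hf hfL
  have h2 := rpow_le_sq_rpow hL hε hfL
  have h3 : L ^ (2 + 2 * ε) = L ^ 2 * (L ^ ε) ^ 2 := by
    rw [Real.rpow_add hL, mul_comm 2 ε, Real.rpow_mul hL.le]; norm_cast
  rw [h3] at hr₁ hr₂
  set p := f ^ (ε / (1 + ε)) with hpdef
  have hp0 : 0 < p := Real.rpow_pos_of_pos hf _
  set m := L ^ ε with hm
  have hm0 : 0 < m := Real.rpow_pos_of_pos hL _
  have hF0 : 0 < F := hf.trans_le hfF
  have hU : a * f ^ 2 / (L * p) + f ≤ (a + 1) * f ^ 2 / (L * p) := by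
    have : f ≤ f ^ 2 / (L * p) := by
      rw [le_div_iff₀ (by positivity)]; nlinarith
    calc _ ≤ a * f ^ 2 / (L * p) + f ^ 2 / (L * p) := by gcongr
      _ = _ := by ring
  calc _ ≤ (a * f ^ 2 / (L * p) + f) * (c * (L ^ 2 * m ^ 2) / (L * δ ^ 2) +
        4 * (c * F * C) * (L ^ 2 * m ^ 2) / (L * δ ^ 2 * f ^ 2)) := by gcongr
    _ ≤ ((a + 1) * f ^ 2 / (L * p)) * (c * (L ^ 2 * m ^ 2) / (L * δ ^ 2) +
        4 * (c * F * C) * (L ^ 2 * m ^ 2) / (L * δ ^ 2 * f ^ 2)) := by gcongr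
    _ = (a + 1) / δ ^ 2 * (c * f ^ 2 + 4 * (c * F * C)) * (m * (m / p)) := by
        field_simp
    _ ≤ (a + 1) / δ ^ 2 * (c * F ^ 2 + 4 * (c * F * C)) * (m * (a * q₀)) := by
        gcongr
        calc m / p ≤ p := by rw [div_le_iff₀ hp0]; nlinarith
          _ ≤ _ := hp
    _ = _ := by ring

variable {lam h : ℕ → ℝ} {d : ℕ}

theorem tendsto_zero_of_rpow (hε : 0 < ε) (hlam : ∀ k, 1 ≤ k → 0 < lam k ∧ lam k ≤ 1)
    (hz : (fun n => lam n ^ (1 + ε)) =o[atTop] (fun _ => (1 : ℝ))) :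
    Tendsto lam atTop (𝓝 0) := by
  have h1 := (isLittleO_one_iff ℝ).1 hz
  have h2 := h1.rpow_const (p := (1 + ε)⁻¹) (Or.inr (by positivity))
  rw [Real.zero_rpow (by positivity)] at h2
  refine h2.congr' ?_
  filter_upwards [eventually_ge_atTop 1] with n hn
  rw [← Real.rpow_mul (hlam n hn).1.le, mul_inv_cancel₀ (by positivity), Real.rpow_one]

/-- Square root of h_n⁴ = o(λ_n^{1+ε}): the bias is negligible against every f(x) above the
threshold. -/
theorem eventually_bandwidth_sq_le (hh : ∀ k, 1 ≤ k → 0 < h k)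
    (hlam : ∀ k, 1 ≤ k → 0 < lam k ∧ lam k ≤ 1)
    (hrate : (fun n => rate d h n + h n ^ 4) =o[atTop] (fun n => lam n ^ (1 + ε)))
    {κ : ℝ} (hκ : 0 < κ) : ∀ᶠ n in atTop, h n ^ 2 ≤ κ * lam n ^ ((1 + ε) / 2) := by
  filter_upwards [hrate.bound (by positivity : 0 < κ ^ 2), eventually_ge_atTop 1] with n hn h1
  have hl := (hlam n h1).1
  have hr : 0 ≤ rate d h n := Real.sqrt_nonneg _
  have hh0 := hh n h1
  rw [Real.norm_of_nonneg (by positivity), Real.norm_of_nonneg (by positivity)] at hn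
  have e : (lam n ^ ((1 + ε) / 2)) ^ 2 = lam n ^ (1 + ε) := by
    rw [← Real.rpow_natCast, ← Real.rpow_mul hl.le]; congr 1; push_cast; ring
  refine (sq_le_sq₀ (by positivity) (by positivity)).1 ?_
  rw [mul_pow, e]
  linarith [show (h n ^ 2) ^ 2 = h n ^ 4 by ring]

theorem eventually_inv_mul_pow_le (hh : ∀ k, 1 ≤ k → 0 < h k)
    (hlam : ∀ k, 1 ≤ k → 0 < lam k ∧ lam k ≤ 1)
    (hrate : (fun n => rate d h n + h n ^ 4) =o[atTop] (fun n => lam n ^ (1 + ε))) :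
    ∀ᶠ n : ℕ in atTop, 1 / (n * h n ^ d) ≤ lam n ^ (2 + 2 * ε) := by
  filter_upwards [hrate.bound one_pos, eventually_ge_atTop 3] with n hn h3
  have h1 : 1 ≤ n := by omega
  have hl := (hlam n h1).1
  have hr : 0 ≤ rate d h n := Real.sqrt_nonneg _
  have hh0 := hh n h1
  rw [Real.norm_of_nonneg (by positivity), Real.norm_of_nonneg (by positivity), one_mul] at hn
  have hn0 : (0 : ℝ) < n := by exact_mod_cast h1
  -- From n ≥ 3 > e on, the logarithm in the rate can be discarded.
  have hlog : 1 ≤ Real.log n := by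
    rw [Real.le_log_iff_exp_le hn0]
    have : (3 : ℝ) ≤ n := by exact_mod_cast h3
    linarith [Real.exp_one_lt_d9]
  have hr2 : rate d h n ^ 2 = Real.log n / (n * h n ^ d) := Real.sq_sqrt (by positivity)
  have e : (lam n ^ (1 + ε)) ^ 2 = lam n ^ (2 + 2 * ε) := by
    rw [← Real.rpow_natCast, ← Real.rpow_mul hl.le]; congr 1; push_cast; ring
  calc 1 / (n * h n ^ d) ≤ Real.log n / (n * h n ^ d) := by gcongr
    _ = rate d h n ^ 2 := hr2.symm
    _ ≤ (lam n ^ (1 + ε)) ^ 2 := by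
        have : 0 ≤ h n ^ 4 := by positivity
        gcongr; linarith
    _ = _ := e

theorem eventually_inv_le (hh : ∀ k, 1 ≤ k → 0 < h k)
    (hlam : ∀ k, 1 ≤ k → 0 < lam k ∧ lam k ≤ 1) (hε : 0 < ε)
    (hrate : (fun n => rate d h n + h n ^ 4) =o[atTop] (fun n => lam n ^ (1 + ε))) :
    ∀ᶠ n : ℕ in atTop, 1 / (n : ℝ) ≤ lam n ^ (2 + 2 * ε) := by
  filter_upwards [eventually_inv_mul_pow_le hh hlam hrate,
    eventually_bandwidth_sq_le hh hlam hrate one_pos, eventually_ge_atTop 1] with n h1 h2 hn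
  have hh0 := hh n hn
  have hn0 : (0 : ℝ) < n := by exact_mod_cast hn
  refine le_trans ?_ h1
  have hl1 : lam n ^ ((1 + ε) / 2) ≤ 1 :=
    Real.rpow_le_one (hlam n hn).1.le (hlam n hn).2 (by positivity)
  have hle : h n ≤ 1 := by nlinarith
  have : h n ^ d ≤ 1 := pow_le_one₀ hh0.le hle
  gcongr
  nlinarith

end Rates

/-! ### Mean convergence of f²/q_n to f. -/

section Consistency

variable {d : ℕ} {Ω : Type*} [MeasurableSpace Ω] {μ : Measure Ω} [IsProbabilityMeasure μ]
  {fU q₀ K : E d → ℝ} {lam h : ℕ → ℝ} {X : ℕ → Ω → E d} {q : ℕ → Ω → E d → ℝ} {ε : ℝ}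

theorem H2.exists_target_bound {f : E d → ℝ} (hq : H2 f q₀) :
    ∃ c F : ℝ, 0 < c ∧ 0 < F ∧ (∀ y, f y ≤ c * q₀ y) ∧ ∀ y, f y ≤ F := by
  obtain ⟨c, hc, h⟩ := hq.dominates 1 one_pos le_rfl
  obtain ⟨Q, hQ, hQ'⟩ := hq.exists_bound
  have h1 : ∀ y, f y ≤ c * q₀ y := fun y => by simpa using h y
  exact ⟨c, c * Q, hc, by positivity, h1, fun y => (h1 y).trans (by gcongr; exact hQ' y)⟩

namespace IsStandardSAIS

/-- Pointwise mean error of `f ^ 2 / q_n`, uniformly with respect to `q₀`. -/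
theorem exists_pointwise_bound (hS : IsStandardSAIS μ fU q₀ K lam h X q)
    (hfU : IsUnnormalizedTarget fU) (hH1 : H1 (target fU)) (hH2 : H2 (target fU) q₀) (hH3 : H3 K)
    (hh : ∀ k, 1 ≤ k → 0 < h k) (hlam : ∀ k, 1 ≤ k → 0 < lam k ∧ lam k ≤ 1)
    (hanti : AntitoneOn lam (Set.Ici 1)) (hε : 0 < ε)
    (hrate : (fun n => rate d h n + h n ^ 4) =o[atTop] (fun n => lam n ^ (1 + ε)))
    (hlz : Tendsto lam atTop (𝓝 0)) :
    ∃ A : ℝ, 0 < A ∧ ∀ δ, 0 < δ → δ ≤ 1 / 8 → ∃ D : ℝ, ∀ᶠ n in atTop, ∀ x,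
      (target fU x ≤ lam n ^ ((1 + ε) / 2) →
        ∫ ω, |target fU x ^ 2 / q n ω x - target fU x| ∂μ ≤ A * q₀ x) ∧
      (lam n ^ ((1 + ε) / 2) < target fU x →
        ∫ ω, |target fU x ^ 2 / q n ω x - target fU x| ∂μ ≤
          (A * (δ + lam n) + D * lam n ^ ε) * q₀ x) := by
  obtain ⟨c, F, hc, hF0, hcf, hF⟩ := hH2.exists_target_bound
  obtain ⟨C, hC0, hC⟩ := hH3.exists_bound
  obtain ⟨M, hM⟩ := hH1.bounded
  have hf0 := hfU.isPDF_target.nonneg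
  have hq0 := hH2.pdf.nonneg
  obtain ⟨B, hB0, hB⟩ := hH3.exists_bias_bound hH1.contDiff hM (F := F)
    (fun x => by rw [abs_of_nonneg (hf0 x)]; exact hF x)
  obtain ⟨a, ha, hap⟩ := hH2.dominates (ε / (1 + ε)) (by positivity)
    (by rw [div_le_one (by positivity)]; linarith)
  -- One constant for both regimes: it absorbs a² + c below the threshold, and 16c (for δ) and 8c +
  -- 4 (for λ_n) above it. Only `D` depends on δ.
  refine ⟨a ^ 2 + 16 * c + 8, by positivity, fun δ hδ hδ8 =>
    ⟨(a + 1) * a / δ ^ 2 * (c * F ^ 2 + 4 * (c * F * C)), ?_⟩⟩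
  -- Chosen so that B h_n² ≤ (δ/2) f(x) above the threshold; B + 1 avoids dividing by B = 0.
  have hκ : 0 < δ / (2 * (B + 1)) := by positivity
  filter_upwards [eventually_bandwidth_sq_le hh hlam hrate hκ,
    eventually_inv_mul_pow_le hh hlam hrate, eventually_inv_le hh hlam hε hrate,
    hlz.eventually (eventually_le_nhds (by norm_num : (0 : ℝ) < 1 / 2)),
    eventually_ge_atTop 1] with n h1 h2 h3 h4 hn x
  have hl := hlam n hn
  have hn0 : (0 : ℝ) < n := by exact_mod_cast hn
  have hhn := hh n hn
  have hql : ∀ ω, lam n * q₀ x ≤ q n ω x :=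
    fun ω => hS.mul_le_policy hfU.nonneg hH3.pdf.nonneg hn hhn hl.2 ω x
  rcases (hf0 x).eq_or_lt' with hfx | hfx
  · have : ∀ Y : ℝ, 0 ≤ Y * q₀ x → ∫ ω, |target fU x ^ 2 / q n ω x - target fU x| ∂μ ≤ Y * q₀ x :=
      fun Y hY => by simpa [hfx] using hY
    refine ⟨fun _ => this _ (mul_nonneg (by positivity) (hq0 x)), fun hlt => absurd hlt ?_⟩
    rw [hfx, not_lt]
    exact Real.rpow_nonneg hl.1.le _
  have hq0x : 0 < q₀ x := by
    by_contra hc'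
    have := hcf x
    nlinarith [hq0 x]
  have hU := sq_div_mul_le_of_rpow_le (ε := ε) hl.1 hfx hq0x (hap x)
  refine ⟨fun hle => ?_, fun hlt => ?_⟩
  · have hbd : target fU x ^ 2 / (lam n * q₀ x) ≤ a ^ 2 * q₀ x :=
      sq_div_mul_le_of_le_rpow hl.1 hε hfx hle hq0x ha (hap x)
    have hpt : ∀ ω, |target fU x ^ 2 / q n ω x - target fU x| ≤ (a ^ 2 + 16 * c + 8) * q₀ x := by
      intro ω
      have hz0 : 0 ≤ target fU x ^ 2 / q n ω x :=
        div_nonneg (sq_nonneg _) ((hS.policy.pdf n ω).nonneg x)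
      have hz : target fU x ^ 2 / q n ω x ≤ a ^ 2 * q₀ x := le_trans (by
        have := hl.1
        gcongr
        exact hql ω) hbd
      have := hcf x
      have := mul_nonneg hc.le hq0x.le
      rw [abs_le]
      have := mul_nonneg (sq_nonneg a) hq0x.le
      constructor <;> linarith
    refine (integral_mono_of_nonneg (ae_of_all _ fun ω => abs_nonneg _) (integrable_const _)
      (ae_of_all _ hpt)).trans_eq (by simp)
  · have hbias : B * h n ^ 2 ≤ δ / 2 * target fU x := by
      calc B * h n ^ 2 ≤ (B + 1) * (δ / (2 * (B + 1)) * lam n ^ ((1 + ε) / 2)) := by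
            gcongr; linarith
        _ = δ / 2 * lam n ^ ((1 + ε) / 2) := by field_simp
        _ ≤ _ := by gcongr
    have key := hS.integral_abs_sq_div_sub_le hfU hq0 hH3.pdf hh hlam hanti hc hcf hF hC hB hn h4
      hδ hδ8 hfx hbias hU
    have hdev := deviation_term_le hl.1 hl.2 hε hfx hlt.le (hF x) ha (hap x) hc hC0.le hδ h3 h2
    have hl0 := hl.1
    have e : c / (n * lam n * δ ^ 2) +
        4 * (c * F * C) / (n * h n ^ d * lam n * δ ^ 2 * target fU x ^ 2) =
        c * (1 / n) / (lam n * δ ^ 2) +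
        4 * (c * F * C) * (1 / (n * h n ^ d)) / (lam n * δ ^ 2 * target fU x ^ 2) := by
      field_simp
    rw [e] at key
    have h16 : 16 * δ * target fU x ≤ (a ^ 2 + 16 * c + 8) * δ * q₀ x :=
      calc 16 * δ * target fU x ≤ 16 * δ * (c * q₀ x) := by gcongr; exact hcf x
        _ = 16 * c * δ * q₀ x := by ring
        _ ≤ _ := by gcongr; linarith [sq_nonneg a]
    have h4l : 4 * lam n * (2 * target fU x + q₀ x) ≤ (a ^ 2 + 16 * c + 8) * lam n * q₀ x :=
      calc 4 * lam n * (2 * target fU x + q₀ x) ≤ 4 * lam n * (2 * (c * q₀ x) + q₀ x) := by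
            gcongr; exact hcf x
        _ = (8 * c + 4) * lam n * q₀ x := by ring
        _ ≤ _ := by
          have : 8 * c + 4 ≤ a ^ 2 + 16 * c + 8 := by linarith [sq_nonneg a]
          gcongr
    refine key.trans ?_
    calc _ ≤ (a ^ 2 + 16 * c + 8) * δ * q₀ x + (a ^ 2 + 16 * c + 8) * lam n * q₀ x +
          (a + 1) * a / δ ^ 2 * (c * F ^ 2 + 4 * (c * F * C)) * lam n ^ ε * q₀ x := by
          gcongr
      _ = _ := by ring

/-- Dominated convergence. For fixed x with f(x) > 0 the vanishing threshold is eventually below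
f(x); n → ∞ at fixed δ, followed by small δ, gives the pointwise limit. -/
theorem tendsto_integral_abs_sq_div_sub (hS : IsStandardSAIS μ fU q₀ K lam h X q)
    (hfU : IsUnnormalizedTarget fU) (hH1 : H1 (target fU)) (hH2 : H2 (target fU) q₀) (hH3 : H3 K)
    (hh : ∀ k, 1 ≤ k → 0 < h k) (hlam : ∀ k, 1 ≤ k → 0 < lam k ∧ lam k ≤ 1)
    (hanti : AntitoneOn lam (Set.Ici 1)) (hε : 0 < ε)
    (hrate : (fun n => rate d h n + h n ^ 4) =o[atTop] (fun n => lam n ^ (1 + ε)))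
    (hlz : Tendsto lam atTop (𝓝 0)) {φ : E d → ℝ} (hφ : Measurable φ) (hφ0 : ∀ x, 0 ≤ φ x)
    (hφi : Integrable fun x => φ x * q₀ x) :
    Tendsto (fun n => ∫ x, φ x * ∫ ω, |target fU x ^ 2 / q n ω x - target fU x| ∂μ) atTop
      (𝓝 0) := by
  obtain ⟨A, hA, hbd⟩ :=
    hS.exists_pointwise_bound hfU hH1 hH2 hH3 hh hlam hanti hε hrate hlz
  have hf0 := hfU.isPDF_target.nonneg
  have hq0 := hH2.pdf.nonneg
  have hle0 : Tendsto (fun n => lam n ^ ε) atTop (𝓝 0) := by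
    have := hlz.rpow_const (p := ε) (Or.inr hε.le)
    rwa [Real.zero_rpow hε.ne'] at this
  have ht0 : Tendsto (fun n => lam n ^ ((1 + ε) / 2)) atTop (𝓝 0) := by
    have := hlz.rpow_const (p := (1 + ε) / 2) (Or.inr (by positivity))
    rwa [Real.zero_rpow (by positivity)] at this
  have he0 : ∀ n x, 0 ≤ ∫ ω, |target fU x ^ 2 / q n ω x - target fU x| ∂μ := fun n x =>
    integral_nonneg fun ω => abs_nonneg _
  have hlim : ∀ x, Tendsto (fun n => ∫ ω, |target fU x ^ 2 / q n ω x - target fU x| ∂μ) atTop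
      (𝓝 0) := by
    intro x
    rcases (hf0 x).eq_or_lt' with hfx | hfx
    · simp [hfx]
    rw [tendsto_order]
    refine ⟨fun a' ha' => Eventually.of_forall fun n => ha'.trans_le (he0 n x), fun τ hτ => ?_⟩
    have hsmall : Tendsto (fun δ : ℝ => A * (δ + 0) * q₀ x) (𝓝[>] 0) (𝓝 0) := by
      have : Tendsto (fun δ : ℝ => A * (δ + 0) * q₀ x) (𝓝 0) (𝓝 (A * (0 + 0) * q₀ x)) :=
        Continuous.tendsto (by fun_prop) 0
      simp only [add_zero, mul_zero, zero_mul] at this ⊢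
      exact this.mono_left nhdsWithin_le_nhds
    obtain ⟨δ, hδτ, hδ0, hδ8⟩ := ((hsmall.eventually_lt_const hτ).and
      (Ioc_mem_nhdsGT (by norm_num : (0 : ℝ) < 1 / 8))).exists
    obtain ⟨D, hD⟩ := hbd δ hδ0 hδ8
    have hbound : Tendsto (fun n => (A * (δ + lam n) + D * lam n ^ ε) * q₀ x) atTop
        (𝓝 ((A * (δ + 0) + D * 0) * q₀ x)) :=
      (((hlz.const_add δ).const_mul A).add (hle0.const_mul D)).mul_const _
    rw [mul_zero, add_zero] at hbound
    filter_upwards [hD, ht0.eventually_lt_const hfx, hbound.eventually_lt_const hδτ] with n h1 h2 h3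
    exact ((h1 x).2 h2).trans_lt h3
  -- For the majorant a multiple of q₀ suffices, so any admissible δ will do.
  obtain ⟨D, hD⟩ := hbd (1 / 8) (by norm_num) le_rfl
  have hub : ∀ᶠ n in atTop, ∀ x, ∫ ω, |target fU x ^ 2 / q n ω x - target fU x| ∂μ ≤
      (A + A * 2 + |D|) * q₀ x := by
    filter_upwards [hD, eventually_ge_atTop 1] with n h1 hn x
    have hl := hlam n hn
    have hle1 : lam n ^ ε ≤ 1 := Real.rpow_le_one hl.1.le hl.2 hε.le
    have hle0 : 0 ≤ lam n ^ ε := Real.rpow_nonneg hl.1.le _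
    rcases le_or_gt (target fU x) (lam n ^ ((1 + ε) / 2)) with hc | hc
    · refine ((h1 x).1 hc).trans ?_
      gcongr
      · exact hq0 x
      · nlinarith [abs_nonneg D]
    · refine ((h1 x).2 hc).trans ?_
      gcongr
      · exact hq0 x
      · nlinarith [hl.2]
      · exact (mul_le_mul_of_nonneg_right (le_abs_self D) hle0).trans
          (mul_le_of_le_one_right (abs_nonneg D) hle1)
  have hmeas : ∀ n, Measurable fun x =>
      φ x * ∫ ω, |target fU x ^ 2 / q n ω x - target fU x| ∂μ := fun n => by
    have h1 : Measurable fun z : Ω × E d => q n z.1 z.2 := hS.policy.measurable_uncurry n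
    have h2 : Measurable fun z : Ω × E d => |target fU z.2 ^ 2 / q n z.1 z.2 - target fU z.2| := by
      have : Measurable fun z : Ω × E d => target fU z.2 :=
        hfU.isPDF_target.measurable.comp measurable_snd
      exact (((this.pow_const 2).div h1).sub this).abs
    exact hφ.mul (h2.stronglyMeasurable.integral_prod_left').measurable
  have := tendsto_integral_filter_of_dominated_convergence (μ := volume) (l := atTop)
    (F := fun n x => φ x * ∫ ω, |target fU x ^ 2 / q n ω x - target fU x| ∂μ) (f := fun _ => 0)
    (fun x => (A + A * 2 + |D|) * (φ x * q₀ x))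
    (Eventually.of_forall fun n => (hmeas n).aestronglyMeasurable)
    (by
      filter_upwards [hub] with n hn
      refine ae_of_all _ fun x => ?_
      rw [Real.norm_of_nonneg (mul_nonneg (hφ0 x) (he0 n x))]
      calc _ ≤ φ x * ((A + A * 2 + |D|) * q₀ x) := mul_le_mul_of_nonneg_left (hn x) (hφ0 x)
        _ = _ := by ring)
    (hφi.const_mul _)
    (ae_of_all _ fun x => by simpa using (hlim x).const_mul (φ x))
  simpa using this

end IsStandardSAIS

end Consistency

/-! ### Integrability and variance identities for g under the target. -/

section Moments

variable {d : ℕ} {f q₀ g : E d → ℝ} {c : ℝ}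

theorem integrable_sq_mul_of_le (hfm : Measurable f) (hf0 : ∀ x, 0 ≤ f x)
    (hf : ∀ x, f x ≤ c * q₀ x) (hg : Measurable g) (hg2 : Integrable fun x => g x ^ 2 * q₀ x) :
    Integrable fun x => g x ^ 2 * f x := by
  refine (hg2.const_mul c).mono' ((hg.pow_const 2).mul hfm).aestronglyMeasurable
    (ae_of_all _ fun x => ?_)
  rw [Real.norm_of_nonneg (mul_nonneg (sq_nonneg _) (hf0 x))]
  calc g x ^ 2 * f x ≤ g x ^ 2 * (c * q₀ x) := by gcongr; exact hf x
    _ = _ := by ring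

theorem integrable_mul_of_sq (hf : IsPDF f) (hg : Measurable g)
    (hg2 : Integrable fun x => g x ^ 2 * f x) : Integrable fun x => g x * f x := by
  refine (hf.integrable.add hg2).mono' (hg.mul hf.measurable).aestronglyMeasurable
    (ae_of_all _ fun x => ?_)
  rw [norm_mul, Real.norm_eq_abs, Real.norm_of_nonneg (hf.nonneg x), Pi.add_apply]
  have : |g x| ≤ 1 + g x ^ 2 := by rw [← sq_abs]; nlinarith [sq_nonneg (|g x| - 1), abs_nonneg (g x)]
  nlinarith [mul_le_mul_of_nonneg_right this (hf.nonneg x)]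

theorem integrable_sub_sq_mul (hf : IsPDF f) (hg : Measurable g)
    (hg2 : Integrable fun x => g x ^ 2 * f x) (m : ℝ) :
    Integrable fun x => (g x - m) ^ 2 * f x := by
  have h1 := integrable_mul_of_sq hf hg hg2
  have : (fun x => (g x - m) ^ 2 * f x) =
      fun x => g x ^ 2 * f x + ((-2 * m) * (g x * f x) + m ^ 2 * f x) := by
    funext x; ring
  rw [this]
  exact hg2.add ((h1.const_mul _).add (hf.integrable.const_mul _))

theorem integral_sub_sq_mul (hf : IsPDF f) (hg : Measurable g)
    (hg2 : Integrable fun x => g x ^ 2 * f x) :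
    ∫ x, (g x - ∫ y, g y * f y) ^ 2 * f x = (∫ x, g x ^ 2 * f x) - (∫ x, g x * f x) ^ 2 := by
  have h1 := integrable_mul_of_sq hf hg hg2
  set m := ∫ y, g y * f y with hm
  have : (fun x => (g x - m) ^ 2 * f x) =
      fun x => g x ^ 2 * f x + ((-2 * m) * (g x * f x) + m ^ 2 * f x) := by
    funext x; ring
  have h2 : Integrable fun x => (-2 * m) * (g x * f x) + m ^ 2 * f x :=
    (h1.const_mul _).add (hf.integrable.const_mul _)
  rw [this, integral_add hg2 h2, integral_add (h1.const_mul _) (hf.integrable.const_mul _),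
    integral_const_mul, integral_const_mul, hf.integral_eq_one, ← hm]
  ring

theorem V_self (f g : E d → ℝ) :
    V f f g = (∫ x, g x ^ 2 * f x) - (∫ x, g x * f x) ^ 2 := by
  unfold V
  congr 2
  funext x
  rcases eq_or_ne (f x) 0 with h | h
  · simp [h]
  · field_simp

theorem integral_withDensity_pdf {p : E d → ℝ} (hp : IsPDF p) (F : E d → ℝ) :
    ∫ x, F x ∂(volume.withDensity fun x => ENNReal.ofReal (p x)) = ∫ x, p x * F x := by
  rw [integral_withDensity_eq_integral_toReal_smul hp.measurable.ennreal_ofReal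
    (ae_of_all _ fun _ => ENNReal.ofReal_lt_top)]
  refine integral_congr_ae (ae_of_all _ fun x => ?_)
  simp [ENNReal.toReal_ofReal (hp.nonneg x)]

theorem importanceVariance_self (hf : IsPDF f) (hg : Measurable g)
    (hg2 : Integrable fun x => g x ^ 2 * f x) :
    importanceVariance f f g = (∫ x, g x ^ 2 * f x) - (∫ x, g x * f x) ^ 2 := by
  unfold importanceVariance
  set P : Measure (E d) := volume.withDensity fun x => ENNReal.ofReal (f x) with hP
  have hprob : IsProbabilityMeasure P := ⟨by
    rw [hP, withDensity_apply _ MeasurableSet.univ, setLIntegral_univ,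
      ← ofReal_integral_eq_lintegral_ofReal hf.integrable (ae_of_all _ hf.nonneg),
      hf.integral_eq_one, ENNReal.ofReal_one]⟩
  have e : ∀ x, f x * (f x / f x * g x) ^ 2 = g x ^ 2 * f x := fun x => by
    rcases eq_or_ne (f x) 0 with h | h
    · simp [h]
    · field_simp
  have e1 : ∀ x, f x * (f x / f x * g x) = g x * f x := fun x => by
    rcases eq_or_ne (f x) 0 with h | h
    · simp [h]
    · field_simp
  have hm : Measurable fun x => f x / f x * g x := (hf.measurable.div hf.measurable).mul hg
  have hL2 : MemLp (fun x => f x / f x * g x) 2 P := by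
    rw [memLp_two_iff_integrable_sq hm.aestronglyMeasurable, hP,
      integrable_withDensity_iff_integrable_smul' hf.measurable.ennreal_ofReal
      (ae_of_all _ fun _ => ENNReal.ofReal_lt_top)]
    refine hg2.congr (ae_of_all _ fun x => ?_)
    simp only [ENNReal.toReal_ofReal (hf.nonneg x), smul_eq_mul, e]
  rw [variance_eq_sub hL2]
  simp only [Pi.pow_apply]
  rw [hP, integral_withDensity_pdf hf, integral_withDensity_pdf hf]
  simp_rw [e, e1]

end Moments

/-! ### Central limit theorem for the weighted evaluations. -/

section Limit

variable {d : ℕ} {Ω : Type*} [MeasurableSpace Ω] {μ : Measure Ω} [IsProbabilityMeasure μ]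
  {X : ℕ → Ω → E d} {q : ℕ → Ω → E d → ℝ} {f ψ : E d → ℝ} {b : ℕ → ℝ}

/-- No separate Lindeberg argument is needed. If a/p ≤ 2, the increment is at most 2|u|; if a/p > 2,
then a²/p ≥ 2a, so a²/p is at most twice its distance to a. -/
theorem sq_div_mul_min_le {a p s u : ℝ} (ha : 0 ≤ a) (hp : 0 ≤ p) :
    a ^ 2 / p * u ^ 2 * min 1 |s * (a / p * u)| ≤
      2 * (|a ^ 2 / p - a| * u ^ 2) + a * u ^ 2 * min 1 (2 * |s| * |u|) := by
  have hz : 0 ≤ a ^ 2 / p := by positivity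
  have hm0 : 0 ≤ min 1 |s * (a / p * u)| := by positivity
  have hr : 0 ≤ a / p := by positivity
  have hle : a ^ 2 / p = a / p * a := by ring
  have hlast : 0 ≤ a * u ^ 2 * min 1 (2 * |s| * |u|) := by positivity
  have hd : a ^ 2 / p ≤ |a ^ 2 / p - a| + a := by linarith [le_abs_self (a ^ 2 / p - a)]
  rcases le_or_gt (a / p) 2 with h | h
  · have hm : min 1 |s * (a / p * u)| ≤ min 1 (2 * |s| * |u|) := by
      refine min_le_min_left _ ?_
      rw [abs_mul, abs_mul, abs_of_nonneg hr]
      calc |s| * (a / p * |u|) ≤ |s| * (2 * |u|) := by gcongr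
        _ = _ := by ring
    calc _ ≤ (|a ^ 2 / p - a| + a) * u ^ 2 * min 1 |s * (a / p * u)| := by gcongr
      _ = |a ^ 2 / p - a| * u ^ 2 * min 1 |s * (a / p * u)| +
          a * u ^ 2 * min 1 |s * (a / p * u)| := by ring
      _ ≤ |a ^ 2 / p - a| * u ^ 2 * 1 + a * u ^ 2 * min 1 (2 * |s| * |u|) := by
          gcongr; exact min_le_left _ _
      _ ≤ _ := by nlinarith [mul_nonneg (abs_nonneg (a ^ 2 / p - a)) (sq_nonneg u)]
  · have h1 : a ^ 2 / p ≤ 2 * |a ^ 2 / p - a| := by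
      have : 2 * a ≤ a ^ 2 / p := by rw [hle]; gcongr
      linarith [le_abs_self (a ^ 2 / p - a)]
    calc _ ≤ 2 * |a ^ 2 / p - a| * u ^ 2 * 1 := by gcongr; exact min_le_left _ _
      _ ≤ _ := by linarith

theorem tendsto_integral_mul_min {p : E d → ℝ} (hp : Integrable p)
    (hp0 : ∀ x, 0 ≤ p x) (hψ : Measurable ψ) :
    Tendsto (fun s : ℝ => ∫ x, p x * min 1 (2 * |s| * |ψ x|)) (𝓝 0) (𝓝 0) := by
  have := tendsto_integral_filter_of_dominated_convergence (μ := volume) (l := 𝓝 (0 : ℝ))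
    (F := fun s x => p x * min 1 (2 * |s| * |ψ x|)) (f := fun _ => 0) p
    (Eventually.of_forall fun s => hp.aestronglyMeasurable.mul
      (by fun_prop : Measurable fun x => min 1 (2 * |s| * |ψ x|)).aestronglyMeasurable)
    (Eventually.of_forall fun s => ae_of_all _ fun x => by
      rw [Real.norm_of_nonneg (mul_nonneg (hp0 x) (by positivity))]
      exact mul_le_of_le_one_right (hp0 x) (min_le_left _ _)) hp
    (ae_of_all _ fun x => by
      have : Tendsto (fun s : ℝ => p x * min 1 (2 * |s| * |ψ x|)) (𝓝 0)
          (𝓝 (p x * min 1 (2 * |(0 : ℝ)| * |ψ x|))) := Continuous.tendsto (by fun_prop) 0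
      simpa using this)
  simpa using this

namespace IsPolicy

theorem integrable_abs_sq_div_sub_mul (hP : IsPolicy μ X q) (k : ℕ)
    (hf : Measurable f) (hf0 : ∀ x, 0 ≤ f x) (hψ : Measurable ψ) (hbk : 0 ≤ b k)
    (hb : ∀ ω y, f y ≤ b k * q k ω y) (hi : Integrable fun y => f y * ψ y ^ 2) :
    Integrable (fun z : Ω × E d => |f z.2 ^ 2 / q k z.1 z.2 - f z.2| * ψ z.2 ^ 2)
      (μ.prod volume) := by
  refine ((hP.integrable_sq_div_mul k hf hf0 hψ hbk hb hi).sub (hi.comp_snd μ)).abs.congr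
    (ae_of_all _ fun z => ?_)
  simp only [Pi.sub_apply]
  rw [← sub_mul, abs_mul, abs_of_nonneg (sq_nonneg (ψ z.2))]

theorem integral_abs_sq_div_sub_mul (hP : IsPolicy μ X q) (k : ℕ)
    (hf : Measurable f) (hf0 : ∀ x, 0 ≤ f x) (hψ : Measurable ψ) (hbk : 0 ≤ b k)
    (hb : ∀ ω y, f y ≤ b k * q k ω y) (hi : Integrable fun y => f y * ψ y ^ 2) :
    ∫ z : Ω × E d, |f z.2 ^ 2 / q k z.1 z.2 - f z.2| * ψ z.2 ^ 2 ∂(μ.prod volume) =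
      ∫ x, ψ x ^ 2 * ∫ ω, |f x ^ 2 / q k ω x - f x| ∂μ := by
  rw [integral_prod_symm _ (hP.integrable_abs_sq_div_sub_mul k hf hf0 hψ hbk hb hi)]
  refine integral_congr_ae (ae_of_all _ fun x => ?_)
  simp only [integral_mul_const]
  rw [mul_comm]

/-- Central limit theorem for sums of importance weighted evaluations. -/
theorem tendstoInDistribution_sum_increment (hP : IsPolicy μ X q)
    (hf : Measurable f) (hf0 : ∀ x, 0 ≤ f x) (hψ : Measurable ψ) (hb0 : ∀ k, 0 ≤ b k)
    (hb : ∀ k ω y, f y ≤ b k * q k ω y) (hi : Integrable fun y => f y * ψ y ^ 2)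
    (hmean : ∫ y, f y * ψ y = 0)
    (hlim : Tendsto (fun n => ∫ x, ψ x ^ 2 * ∫ ω, |f x ^ 2 / q n ω x - f x| ∂μ) atTop (𝓝 0)) :
    TendstoInDistribution (fun (n : ℕ) ω => (√n)⁻¹ * ∑ k ∈ Finset.range n, increment f q X ψ k ω)
      atTop (id : ℝ → ℝ) (fun _ => μ) (gaussianReal 0 (∫ y, f y * ψ y ^ 2).toNNReal) := by
  have hA : ∀ k, ∫ z : Ω × E d, |f z.2 ^ 2 / q k z.1 z.2 - f z.2| * ψ z.2 ^ 2 ∂(μ.prod volume) =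
      ∫ x, ψ x ^ 2 * ∫ ω, |f x ^ 2 / q k ω x - f x| ∂μ := fun k =>
    hP.integral_abs_sq_div_sub_mul k hf hf0 hψ (hb0 k) (hb k) hi
  have hAi := fun k => hP.integrable_abs_sq_div_sub_mul (μ := μ) k hf hf0 hψ (hb0 k) (hb k) hi
  simp_rw [← hA] at hlim
  have hΦ : ∀ k (s : ℝ), Measurable[history X k] fun ω => Complex.exp
      ((s * ∑ j ∈ Finset.range k, increment f q X ψ j ω : ℝ) * Complex.I) := fun k s => by
    have h1 := hP.measurable_sum_increment_history hf hψ 0 k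
    simp only [sub_zero] at h1
    have h2 : Measurable fun x : ℝ => Complex.exp ((s * x : ℝ) * Complex.I) := by fun_prop
    exact h2.comp h1
  refine tendstoInDistribution_sum_of_charFun_increments (hP.measurable_increment hf hψ)
    (fun k => hP.integrable_increment_sq k hf hf0 hψ (hb0 k) (hb k) hi)
    (integral_nonneg fun y => mul_nonneg (hf0 y) (sq_nonneg _))
    -- The factor 2 comes from the truncated second moment; the conditional variance needs only half
    -- of it.
    (A := fun k => 2 * ∫ z : Ω × E d,
      |f z.2 ^ 2 / q k z.1 z.2 - f z.2| * ψ z.2 ^ 2 ∂(μ.prod volume))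
    (B := fun s => ∫ x, f x * ψ x ^ 2 * min 1 (2 * |s| * |ψ x|))
    (by simpa using hlim.const_mul 2)
    (tendsto_integral_mul_min hi (fun x => mul_nonneg (hf0 x) (sq_nonneg _)) hψ) ?_ ?_ ?_
  · intro k s
    have := hP.integral_mul_increment (𝕜 := ℂ) hf hf0 hψ (hb k) (hΦ k s)
    rw [hmean] at this
    simpa using this
  · intro k s
    set Φ : Ω → ℂ := fun ω => Complex.exp
      ((s * ∑ j ∈ Finset.range k, increment f q X ψ j ω : ℝ) * Complex.I) with hΦdef
    have hΦn : ∀ ω, ‖Φ ω‖ = 1 := fun ω => Complex.norm_exp_ofReal_mul_I _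
    have hΦm : Measurable Φ := (hΦ k s).mono (hP.history_le k) le_rfl
    have hΦi : Integrable Φ μ := (integrable_const (1 : ℝ)).mono' hΦm.aestronglyMeasurable
      (ae_of_all _ fun ω => (hΦn ω).le)
    have hD2 := hP.integrable_increment_sq k hf hf0 hψ (hb0 k) (hb k) hi
    have hF : StronglyMeasurable[(history X k).prod inferInstance] fun z : Ω × E d => Φ z.1 :=
      ((hΦ k s).comp (@measurable_fst Ω (E d) (history X k) inferInstance)).stronglyMeasurable
    have e1 := hP.integral_increment_comp k hF hf hψ
    have e2 : ∫ z : Ω × E d, (f z.2 * ψ z.2 ^ 2) • Φ z.1 ∂(μ.prod volume) =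
        (∫ ω, Φ ω ∂μ) * ((∫ y, f y * ψ y ^ 2 : ℝ) : ℂ) := by
      rw [← integral_complex_ofReal, ← integral_prod_mul]
      refine integral_congr_ae (ae_of_all _ fun z => ?_)
      simp only [Complex.real_smul]
      rw [mul_comm]
    have i1 : Integrable (fun z : Ω × E d => (f z.2 ^ 2 / q k z.1 z.2 * ψ z.2 ^ 2) • Φ z.1)
        (μ.prod volume) :=
      (hP.integrable_sq_div_mul k hf hf0 hψ (hb0 k) (hb k) hi).smul_bdd 1
        (hΦm.comp measurable_fst).aestronglyMeasurable (ae_of_all _ fun z => (hΦn _).le)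
    have i2 : Integrable (fun z : Ω × E d => (f z.2 * ψ z.2 ^ 2) • Φ z.1) (μ.prod volume) :=
      (hi.comp_snd μ).smul_bdd 1
        (hΦm.comp measurable_fst).aestronglyMeasurable (ae_of_all _ fun z => (hΦn _).le)
    have i3 : Integrable (fun ω => increment f q X ψ k ω ^ 2 • Φ ω) μ :=
      hD2.smul_bdd 1 hΦm.aestronglyMeasurable (ae_of_all _ fun z => (hΦn _).le)
    -- As Φ depends only on the past, the deviation of D_k² from v becomes that of f²/q_k from f,
    -- whose absolute value is controlled in mean.
    have e3 : ∫ ω, Φ ω * ((increment f q X ψ k ω ^ 2 - ∫ y, f y * ψ y ^ 2 : ℝ) : ℂ) ∂μ =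
        ∫ z : Ω × E d, ((f z.2 ^ 2 / q k z.1 z.2 - f z.2) * ψ z.2 ^ 2) • Φ z.1 ∂(μ.prod volume) := by
      have e4 : ∀ ω, Φ ω * ((increment f q X ψ k ω ^ 2 - ∫ y, f y * ψ y ^ 2 : ℝ) : ℂ) =
          increment f q X ψ k ω ^ 2 • Φ ω - Φ ω * ((∫ y, f y * ψ y ^ 2 : ℝ) : ℂ) := fun ω => by
        rw [Complex.real_smul, Complex.ofReal_sub]; ring
      simp_rw [e4, sub_mul, sub_smul]
      rw [integral_sub i3 (hΦi.mul_const _), integral_sub i1 i2, e2, integral_mul_const, e1]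
    rw [e3]
    refine (norm_integral_le_of_norm_le (hAi k) (ae_of_all _ fun z => ?_)).trans ?_
    · rw [norm_smul, hΦn, mul_one, norm_mul, Real.norm_eq_abs,
        Real.norm_of_nonneg (sq_nonneg (ψ z.2))]
    · have : 0 ≤ ∫ z : Ω × E d, |f z.2 ^ 2 / q k z.1 z.2 - f z.2| * ψ z.2 ^ 2 ∂(μ.prod volume) :=
        integral_nonneg fun z => by positivity
      linarith
  · intro k s
    have hF : StronglyMeasurable[(history X k).prod inferInstance] fun z : Ω × E d =>
        min 1 |s * (f z.2 / q k z.1 z.2 * ψ z.2)| := by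
      refine Measurable.stronglyMeasurable ?_
      have h1 := hP.adapted k
      have h3 := hf.comp (@measurable_snd Ω (E d) (history X k) inferInstance)
      have h4 := hψ.comp (@measurable_snd Ω (E d) (history X k) inferInstance)
      have h5 : Measurable fun x : ℝ => min 1 |s * x| := by fun_prop
      exact h5.comp ((h3.div h1).mul h4)
    have e1 := hP.integral_increment_comp k hF hf hψ
    simp only [smul_eq_mul] at e1
    have i2 : Integrable (fun y => f y * ψ y ^ 2 * min 1 (2 * |s| * |ψ y|)) :=
      hi.mul_bdd (c := 1)
        (by fun_prop : Measurable fun x => min 1 (2 * |s| * |ψ x|)).aestronglyMeasurable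
        (ae_of_all _ fun x => by
          rw [Real.norm_of_nonneg (by positivity)]; exact min_le_left _ _)
    have hint := ((hAi k).const_mul 2).add (i2.comp_snd μ)
    rw [show ∫ ω, increment f q X ψ k ω ^ 2 * min 1 |s * increment f q X ψ k ω| ∂μ = _ from e1]
    refine (integral_mono_of_nonneg (ae_of_all _ fun z => ?_) hint
      (ae_of_all _ fun z => sq_div_mul_min_le (hf0 z.2) ((hP.pdf k z.1).nonneg z.2))).trans_eq ?_
    · have := (hP.pdf k z.1).nonneg z.2
      simp only [Pi.zero_apply]
      positivity
    · simp only [Pi.add_apply]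
      rw [integral_add ((hAi k).const_mul 2) (i2.comp_snd μ), integral_const_mul,
        integral_fun_snd (fun y => f y * ψ y ^ 2 * min 1 (2 * |s| * |ψ y|))]
      simp

end IsPolicy

end Limit

/-! ### Average weight and Slutsky's lemma. -/

section Normalization

variable {d : ℕ} {Ω : Type*} [MeasurableSpace Ω] {μ : Measure Ω}
  {fU q₀ K g : E d → ℝ} {lam h : ℕ → ℝ} {X : ℕ → Ω → E d} {q : ℕ → Ω → E d → ℝ} {ε : ℝ}

theorem IsPolicy.measurable_weight (hP : IsPolicy μ X q) (hfU : Measurable fU) {k : ℕ}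
    (hk : 1 ≤ k) : Measurable fun ω => weight fU (fun j => q j ω) (fun j => X j ω) k := by
  have hX := hP.measurable k hk
  exact (hfU.comp hX).div ((hP.measurable_uncurry (k - 1)).comp (measurable_id.prodMk hX))

theorem IsPolicy.measurable_estimate (hP : IsPolicy μ X q) (hfU : Measurable fU)
    (hg : Measurable g) (n : ℕ) :
    Measurable fun ω => estimate fU (fun j => q j ω) (fun j => X j ω) g n := by
  have hsum : Measurable fun ω =>
      ∑ j ∈ Finset.Icc 1 n, weight fU (fun j => q j ω) (fun j => X j ω) j :=
    Finset.measurable_sum _ fun j hj => hP.measurable_weight hfU (Finset.mem_Icc.1 hj).1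
  refine Finset.measurable_sum _ fun k hk => Measurable.mul ?_
    (hg.comp (hP.measurable k (Finset.mem_Icc.1 hk).1))
  unfold normWeight
  exact Measurable.ite (measurableSet_eq_fun hsum measurable_const) measurable_const
    ((hP.measurable_weight hfU (Finset.mem_Icc.1 hk).1).div hsum)

variable [IsProbabilityMeasure μ]

theorem tendstoInMeasure_of_integral_sub_sq {Y : ℕ → Ω → ℝ} {a : ℝ}
    (hY : ∀ᶠ n in atTop, Integrable (fun ω => (Y n ω - a) ^ 2) μ)
    (hlim : Tendsto (fun n => ∫ ω, (Y n ω - a) ^ 2 ∂μ) atTop (𝓝 0)) :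
    TendstoInMeasure μ Y atTop (fun _ => a) := by
  rw [tendstoInMeasure_iff_measureReal_norm]
  intro τ hτ
  have hlim' := hlim.const_mul (τ ^ 2)⁻¹
  rw [mul_zero] at hlim'
  refine tendsto_of_tendsto_of_tendsto_of_le_of_le' tendsto_const_nhds hlim'
    (Eventually.of_forall fun _ => measureReal_nonneg) ?_
  filter_upwards [hY] with n hn
  have := mul_meas_ge_le_integral_of_nonneg (ae_of_all _ fun ω => sq_nonneg (Y n ω - a)) hn (τ ^ 2)
  rw [← div_eq_inv_mul, le_div_iff₀ (by positivity), mul_comm]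
  refine le_trans ?_ this
  refine mul_le_mul_of_nonneg_left (measureReal_mono fun ω hω => ?_) (sq_nonneg τ)
  simp only [Set.mem_ofPred_eq, Real.norm_eq_abs] at hω ⊢
  rw [← sq_abs (Y n ω - a)]
  gcongr

namespace IsStandardSAIS

/-- The average importance weight converges to `1` in probability. -/
theorem tendstoInMeasure_average_weight (hS : IsStandardSAIS μ fU q₀ K lam h X q)
    (hfU : IsUnnormalizedTarget fU) (hH2 : H2 (target fU) q₀) (hK : ∀ y, 0 ≤ K y)
    (hh : ∀ k, 1 ≤ k → 0 < h k) (hlam : ∀ k, 1 ≤ k → 0 < lam k ∧ lam k ≤ 1)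
    (hanti : AntitoneOn lam (Set.Ici 1)) (hε : 0 < ε)
    (hrate : (fun n => rate d h n + h n ^ 4) =o[atTop] (fun n => lam n ^ (1 + ε)))
    (hlz : Tendsto lam atTop (𝓝 0)) :
    TendstoInMeasure μ (fun (n : ℕ) ω =>
      (∑ k ∈ Finset.range n, increment (target fU) q X (fun _ => 1) k ω) / n) atTop
      (fun _ => (1 : ℝ)) := by
  obtain ⟨c, F, hc, -, hcf, -⟩ := hH2.exists_target_bound
  have hp := hfU.isPDF_target
  have key : ∀ n : ℕ, 1 ≤ n → _ := fun n hn =>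
    hS.integral_average_sub_sq_le hfU hK hh hlam hanti hc hcf (measurable_const (a := (1 : ℝ)))
      (by simpa using hp.integrable) hn
  simp only [mul_one, one_pow, hp.integral_eq_one] at key
  refine tendstoInMeasure_of_integral_sub_sq
    ((eventually_ge_atTop 1).mono fun n hn => (key n hn).1) ?_
  have hlim : Tendsto (fun n => c * lam n) atTop (𝓝 0) := by simpa using hlz.const_mul c
  refine tendsto_of_tendsto_of_tendsto_of_le_of_le' tendsto_const_nhds hlim
    (Eventually.of_forall fun n => integral_nonneg fun ω => sq_nonneg _) ?_
  filter_upwards [eventually_inv_le hh hlam hε hrate, eventually_ge_atTop 1] with n h1 hn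
  have hl := hlam n hn
  have hl0 := hl.1
  have hn0 : (0 : ℝ) < n := by exact_mod_cast hn
  -- This turns the mean square error c/(nλ_n) into at most cλ_n.
  have h2 : 1 / (n : ℝ) ≤ lam n ^ 2 := h1.trans (by
    rw [← Real.rpow_natCast]
    exact Real.rpow_le_rpow_of_exponent_ge hl.1 hl.2 (by push_cast; linarith))
  refine (key n hn).2.trans ?_
  calc c / (n * lam n) = c * (1 / n) / lam n := by field_simp
    _ ≤ c * lam n ^ 2 / lam n := by gcongr
    _ = c * lam n := by field_simp

/-- Centering g at ∫gf puts the numerator in the scope of the martingale theorem, and (g − ∫gf)² q₀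
is integrable because g² q₀ and q₀ are. -/
theorem tendstoInDistribution_estimate (hS : IsStandardSAIS μ fU q₀ K lam h X q)
    (hfU : IsUnnormalizedTarget fU) (hH1 : H1 (target fU)) (hH2 : H2 (target fU) q₀) (hH3 : H3 K)
    (hh : ∀ k, 1 ≤ k → 0 < h k) (hlam : ∀ k, 1 ≤ k → 0 < lam k ∧ lam k ≤ 1)
    (hanti : AntitoneOn lam (Set.Ici 1)) (hε : 0 < ε)
    (hrate : (fun n => rate d h n + h n ^ 4) =o[atTop] (fun n => lam n ^ (1 + ε)))
    (hlz : Tendsto lam atTop (𝓝 0)) (hg : Measurable g)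
    (hg2 : Integrable fun x => g x ^ 2 * q₀ x) :
    TendstoInDistribution (fun (n : ℕ) ω => √(n : ℝ) *
      (estimate fU (fun j => q j ω) (fun j => X j ω) g n - ∫ x, g x * target fU x)) atTop
      (id : ℝ → ℝ) (fun _ => μ)
      (gaussianReal 0 (∫ y, target fU y * (g y - ∫ x, g x * target fU x) ^ 2).toNNReal) := by
  obtain ⟨c, F, hc, -, hcf, -⟩ := hH2.exists_target_bound
  have hp := hfU.isPDF_target
  set f := target fU with hfdef
  set m := ∫ x, g x * f x with hm
  have hψ : Measurable fun y => g y - m := hg.sub_const m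
  have hgf2 := integrable_sq_mul_of_le hp.measurable hp.nonneg hcf hg hg2
  have hgf := integrable_mul_of_sq hp hg hgf2
  have hi : Integrable fun y => f y * (g y - m) ^ 2 := by
    simpa only [mul_comm] using integrable_sub_sq_mul hp hg hgf2 m
  have hmean : ∫ y, f y * (g y - m) = 0 := by
    have e : ∀ y, f y * (g y - m) = g y * f y - m * f y := fun y => by ring
    simp_rw [e]
    rw [integral_sub hgf (hp.integrable.const_mul m), integral_const_mul, hp.integral_eq_one,
      ← hm]
    ring
  have hclt := hS.policy.tendstoInDistribution_sum_increment hp.measurable hp.nonneg hψ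
    (dominance_nonneg hc.le hlam)
    (hS.le_dominance_mul hfU.nonneg hH3.pdf.nonneg hh hlam hc hcf) hi hmean
    (hS.tendsto_integral_abs_sq_div_sub hfU hH1 hH2 hH3 hh hlam hanti hε hrate hlz
      (hψ.pow_const 2) (fun x => sq_nonneg _) (integrable_sub_sq_mul hH2.pdf hg hg2 m))
  have hone := hS.tendstoInMeasure_average_weight hfU hH2 hH3.pdf.nonneg hh hlam hanti hε hrate hlz
  rw [← hfdef] at hone
  have hSm : ∀ n : ℕ, Measurable fun ω =>
      (∑ k ∈ Finset.range n, increment f q X (fun _ => 1) k ω) / n := fun n =>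
    (Finset.measurable_sum _ fun k _ =>
      hS.policy.measurable_increment hp.measurable measurable_const k).div_const _
  -- A continuous substitute for the quotient. The two agree when the average weight is at least
  -- 1/2, and the complementary event has vanishing probability.
  have hcont : Continuous fun z : ℝ × ℝ => z.1 / max z.2 (1 / 2) :=
    continuous_fst.div (continuous_snd.max continuous_const) fun z =>
      (lt_of_lt_of_le (by norm_num : (0 : ℝ) < 1 / 2) (le_max_right _ _)).ne'
  have hslut := hclt.continuous_comp_prodMk_of_tendstoInMeasure_const hcont hone
    (fun n => (hSm n).aemeasurable)
  have hid : (fun ω : ℝ => (fun z : ℝ × ℝ => z.1 / max z.2 (1 / 2)) (id ω, 1)) = id := by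
    funext ω
    norm_num
  rw [hid] at hslut
  refine tendstoInDistribution_of_tendstoInMeasure_sub _ _ hslut ?_ fun n =>
    (((hS.policy.measurable_estimate hfU.measurable hg n).sub_const m).const_mul _).aemeasurable
  rw [tendstoInMeasure_iff_measureReal_norm] at hone ⊢
  intro τ hτ
  refine tendsto_of_tendsto_of_tendsto_of_le_of_le' tendsto_const_nhds
    (hone (1 / 2) (by norm_num)) (Eventually.of_forall fun _ => measureReal_nonneg) ?_
  filter_upwards [eventually_ge_atTop 1] with n hn
  refine measureReal_mono fun ω hω => ?_
  simp only [Set.mem_ofPred_eq, Real.norm_eq_abs, Pi.sub_apply, Pi.zero_apply, sub_zero] at hω ⊢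
  by_contra! hlt
  have hS12 : 1 / 2 ≤ (∑ k ∈ Finset.range n, increment f q X (fun _ => 1) k ω) / n := by
    linarith [(abs_lt.1 hlt).1]
  rw [sqrt_mul_estimate_sub hfU q X g hn m ω (by
    have : (0 : ℝ) < 1 / 2 := by norm_num
    exact (this.trans_le hS12).ne'), max_eq_left hS12, sub_self, abs_zero] at hω
  linarith

end IsStandardSAIS

end Normalization

end SAIS

end

/-! ### The oracle central limit theorem. -/

theorem theorem2 {d : ℕ} {Ω : Type*} [MeasurableSpace Ω] (μ : Measure Ω) [IsProbabilityMeasure μ]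
    (fU q₀ K : SAIS.E d → ℝ) (hfU : SAIS.IsUnnormalizedTarget fU)
    (hH1 : SAIS.H1 (SAIS.target fU)) (hH2 : SAIS.H2 (SAIS.target fU) q₀) (hH3 : SAIS.H3 K)
    (lam h : ℕ → ℝ)
    (hh : ∀ k, 1 ≤ k → 0 < h k)
    (hlam : ∀ k, 1 ≤ k → 0 < lam k ∧ lam k ≤ 1)
    (hlam_anti : AntitoneOn lam (Set.Ici 1))
    (X : ℕ → Ω → SAIS.E d) (q : ℕ → Ω → SAIS.E d → ℝ)
    (hSAIS : SAIS.IsStandardSAIS μ fU q₀ K lam h X q)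
    (ε : ℝ) (hε : 0 < ε)
    (hrate : (fun n => SAIS.rate d h n + h n ^ 4) =o[atTop] (fun n => lam n ^ (1 + ε)))
    (hlam_zero : (fun n => lam n ^ (1 + ε)) =o[atTop] (fun _ => (1 : ℝ)))
    (g : SAIS.E d → ℝ) (hg : Measurable g) (hg2 : Integrable fun x => g x ^ 2 * q₀ x) :
    Integrable (fun x => g x * SAIS.target fU x) ∧
    Integrable (fun x => g x ^ 2 * SAIS.target fU x) ∧
    SAIS.V (SAIS.target fU) (SAIS.target fU) g
      = (∫ x, g x ^ 2 * SAIS.target fU x) - (∫ x, g x * SAIS.target fU x) ^ 2 ∧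
    SAIS.V (SAIS.target fU) (SAIS.target fU) g
      = SAIS.importanceVariance (SAIS.target fU) (SAIS.target fU) g ∧
    TendstoInDistribution
      (fun (n : ℕ) (ω : Ω) =>
        √(n : ℝ) * (SAIS.estimate fU (fun j => q j ω) (fun j => X j ω) g n
          - ∫ x, g x * SAIS.target fU x))
      atTop (id : ℝ → ℝ) (fun _ => μ)
      (gaussianReal 0 (SAIS.V (SAIS.target fU) (SAIS.target fU) g).toNNReal) := by
  obtain ⟨c, F, hc, -, hcf, -⟩ := hH2.exists_target_bound
  have hp := hfU.isPDF_target
  have hgf2 := SAIS.integrable_sq_mul_of_le hp.measurable hp.nonneg hcf hg hg2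
  have hV := SAIS.V_self (SAIS.target fU) g
  refine ⟨SAIS.integrable_mul_of_sq hp hg hgf2, hgf2, hV,
    hV.trans (SAIS.importanceVariance_self hp hg hgf2).symm, ?_⟩
  have hlz := SAIS.tendsto_zero_of_rpow hε hlam hlam_zero
  have hmain := hSAIS.tendstoInDistribution_estimate hfU hH1 hH2 hH3 hh hlam hlam_anti hε hrate
    hlz hg hg2
  have hv : ∫ y, SAIS.target fU y * (g y - ∫ x, g x * SAIS.target fU x) ^ 2 =
      SAIS.V (SAIS.target fU) (SAIS.target fU) g := by
    rw [hV, ← SAIS.integral_sub_sq_mul hp hg hgf2]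
    simp only [mul_comm]
  rwa [hv] at hmain
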